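/- \textbf{Setting.} Let $d\ge 1$, $\Theta=[\theta_{\inf},\theta_{\sup}]^p\subset\mathbb{R}^p$, and let $\theta_0\in\Theta$ satisfy $\theta_{\inf}<(\theta_0)_i<\theta_{\sup}$ for $1\le i\le p$. Let $\{K_\theta,\theta\in\Theta\}$ be a family of functions $K_\theta:\mathbb{R}^d\to\mathbb{R}$ such that: \begin{itemize} \item each $K_\theta$ is a stationary covariance function; \item $K_\theta(t)$ is three times differentiable with respect to $\theta\in\Theta$, and for all $q\in\{0,\dots,3\}$ and $i_1,\dots,i_q\in\{1,\dots,p\}$ there is $C_{i_1,\dots,i_q}<\infty$ such that $\left|\frac{\partial}{\partial\theta_{i_1}}\cdots\frac{\partial}{\partial\theta_{i_q}}K_\theta(t)\right|\le \frac{C_{i_1,\dots,i_q}}{1+|t|^{d+1}}$ for all $\theta\in\Theta$, $t\in\mathbb{R}^d$ ($|t|$ is the Euclidean norm); \item with $\hat K_\theta(f)=\frac1{(2\pi)^d}\int_{\mathbb{R}^d}K_\theta(t)e^{-\mathrm{i}f\cdot t}\,dt$, one has $K_\theta(t)=\int_{\mathbb{R}^d}\hat K_\theta(f)e^{\mathrm{i}f\cdot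 t}\,df$ (both integrals being absolutely convergent), and $(f,\theta)\mapsto\hat K_\theta(f)$ is real valued, positive and continuous on $\mathbb{R}^d\times\Theta$. \end{itemize} Let $(v_i)_{i\ge1}$ be a deterministic sequence in $\{1,2,\dots\}^d$ with $\{v_i:1\le i\le N^d\}=\{1,\dots,N\}^d$ for all $N\ge1$, and let $\epsilon\in[0,\frac12)$. Let $(X_i)_{i\ge1}$ be i.i.d. with law $\mathcal{L}_X$, a symmetric probability distribution on $\mathbb{R}^d$ whose support $S_X$ is contained in $[-1,1]^d$ and which has a probability density that is positive on $S_X$. Let $Y$ be a centered Gaussian process on $\mathbb{R}^d$ with covariance function $(s,t)\mapsto K_{\theta_0}(s-t)$, independent of $(X_i)$ in the sense that $(X_i)$ and $Y$ are defined on the two factors of a product probability space. The observations are $y_i=Y(v_i+\epsilon X_i)$, $1\le i\le n$. For $\theta\in\Theta$ let $\hat y_{i,\theta}(y_{-i})$ be the leave-one-out Kriging prediction of $y_i$, i.e. the conditional mean, given $X$ and $y_j$ ($1\le j\le n$, $j\ne i$), of $y_i$ under the covariance function $K_\theta$: explicitly $\hat y_{i,\theta}(y_{-i})=r_{i,\theta}^t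 R_{-i,\theta}^{-1}y_{-i}$, where $R_\theta=\big(K_\theta(v_j-v_k+\epsilon(X_j-X_k))\big)_{1\le j,k\le n}$, $R_{-i,\theta}$ is $R_\theta$ without its $i$-th row and column, and $r_{i,\theta}$ is the $i$-th column of $R_\theta$ without its $i$-th entry. For each $n\ge1$ let $\hat\theta_{CV}=\hat\theta_{CV,n}$ be any element of $$\mathop{\mathrm{argmin}}_{\theta\in\Theta}\ \sum_{i=1}^n\{y_i-\hat y_{i,\theta}(y_{-i})\}^2 \quad\text{(almost surely)}.$$ \textbf{Proposition.} Assume moreover that $K_\theta(0)=1$ for all $\theta\in\Theta$. \begin{enumerate} \item If $\epsilon=0$ and there is no $\theta\in\Theta$, $\theta\ne\theta_0$, with $K_\theta(v)=K_{\theta_0}(v)$ for all $v\in\mathbb{Z}^d$, then $\hat\theta_{CV}\to\theta_0$ in probability as $n\to\infty$. \item If $\epsilon\neq0$, let $D_\epsilon=\bigcup_{v\in\mathbb{Z}^d\setminus\{0\}}(v+\epsilon C_{S_X})$ with $C_{S_X}=\{t_1-t_2:t_1,t_2\in S_X\}$. If there is no $\theta\in\Theta$, $\theta\ne\theta_0$,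 with $K_\theta=K_{\theta_0}$ Lebesgue-almost everywhere on $D_\epsilon$, then $\hat\theta_{CV}\to\theta_0$ in probability as $n\to\infty$. \end{enumerate} -/

import Mathlib

open MeasureTheory ProbabilityTheory Filter Topology
open scoped Matrix ENNReal

noncomputable section

/-! ### The parametric covariance model -/

/-- The parameter space `Θ = [a, b]^p`. -/
def paramCube (p : ℕ) (a b : ℝ) : Set (Fin p → ℝ) :=
  {θ | ∀ i, θ i ∈ Set.Icc a b}

/-- `k` is the covariance function `(s, t) ↦ k (s - t)` of a real second order stationary process
on `ℝ^d`: it is even and positive semidefinite. -/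
def IsStationaryCovariance {d : ℕ} (k : EuclideanSpace ℝ (Fin d) → ℝ) : Prop :=
  (∀ t, k (-t) = k t) ∧
    ∀ (n : ℕ) (s : Fin n → EuclideanSpace ℝ (Fin d)) (c : Fin n → ℝ),
      0 ≤ ∑ i, ∑ j, c i * c j * k (s i - s j)

/-- The Fourier transform `ĥ(f) = (2π)^{-d} ∫ h(t) e^{-i f·t} dt`. -/
def fourierHat {d : ℕ} (h : EuclideanSpace ℝ (Fin d) → ℝ) (f : EuclideanSpace ℝ (Fin d)) : ℂ :=
  (1 / (2 * (Real.pi : ℂ)) ^ d) *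
    ∫ t, (h t : ℂ) * Complex.exp (-Complex.I * ((inner ℝ f t : ℝ) : ℂ))

/-- The regularity condition on a parametric family `K θ`, `θ ∈ Θ = [a, b]^p`, of covariance
functions on `ℝ^d`. Only the values of `K` at parameters in `Θ` matter; derivatives in `θ` are
taken within `Θ` (so they are one-sided on its boundary). -/
structure IsRegularCovarianceModel {d p : ℕ} (a b : ℝ)
    (K : (Fin p → ℝ) → EuclideanSpace ℝ (Fin d) → ℝ) : Prop where
  stationary : ∀ θ ∈ paramCube p a b, IsStationaryCovariance (K θ)
  /-- Three times differentiable in `θ`: the derivatives of orders `0, 1, 2` are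
  differentiable. -/
  differentiable : ∀ (t : EuclideanSpace ℝ (Fin d)), ∀ q < 3,
    DifferentiableOn ℝ (iteratedFDerivWithin ℝ q (fun θ => K θ t) (paramCube p a b))
      (paramCube p a b)
  /-- All the partial derivatives `∂/∂θ_{i 0} ⋯ ∂/∂θ_{i (q-1)} K θ t` of order `q ≤ 3` are
  dominated by `C / (1 + |t|^{d+1})`, uniformly in `θ` and `t`. -/
  bound : ∀ q ≤ 3, ∀ i : Fin q → Fin p, ∃ C : ℝ, ∀ θ ∈ paramCube p a b,
    ∀ t : EuclideanSpace ℝ (Fin d),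
      |iteratedFDerivWithin ℝ q (fun θ' => K θ' t) (paramCube p a b) θ
          (fun j => Pi.single (i j) (1 : ℝ))| ≤ C / (1 + ‖t‖ ^ (d + 1))
  /-- The Fourier transform is defined by a convergent integral. -/
  integrable : ∀ θ ∈ paramCube p a b, Integrable (K θ)
  /-- The Fourier inversion integral converges. -/
  integrable_hat : ∀ θ ∈ paramCube p a b, Integrable (fourierHat (K θ))
  inversion : ∀ θ ∈ paramCube p a b, ∀ t : EuclideanSpace ℝ (Fin d),
    (K θ t : ℂ) =
      ∫ f, fourierHat (K θ) f * Complex.exp (Complex.I * ((inner ℝ f t : ℝ) : ℂ))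
  hat_continuous : ContinuousOn
    (fun x : EuclideanSpace ℝ (Fin d) × (Fin p → ℝ) => fourierHat (K x.2) x.1)
    (Set.univ ×ˢ paramCube p a b)
  /-- The Fourier transform is real and positive. -/
  hat_pos : ∀ θ ∈ paramCube p a b, ∀ f : EuclideanSpace ℝ (Fin d),
    0 < (fourierHat (K θ) f).re ∧ (fourierHat (K θ) f).im = 0

/-! ### The randomly perturbed regular grid -/

/-- `v` enumerates `{1, 2, …}^d` so that, for every `N ≥ 1`, its first `N^d` terms are exactly the
points of `{1, …, N}^d` (indices start at `0`). -/
def IsGridEnumeration {d : ℕ} (v : ℕ → Fin d → ℕ) : Prop :=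
  ∀ N : ℕ, 1 ≤ N → v '' {i | i < N ^ d} = {u | ∀ k, 1 ≤ u k ∧ u k ≤ N}

/-- The law of the perturbations: a symmetric probability distribution whose (topological) support
lies in `[-1, 1]^d`, with a probability density that is positive on the support. -/
structure IsPerturbationLaw {d : ℕ} (L : Measure (EuclideanSpace ℝ (Fin d))) : Prop where
  prob : IsProbabilityMeasure L
  symm : L.map (fun x => -x) = L
  support_subset : ∀ x ∈ L.support, ∀ k, x k ∈ Set.Icc (-1 : ℝ) 1
  density : ∃ f : EuclideanSpace ℝ (Fin d) → ℝ≥0∞, Measurable f ∧ L = volume.withDensity f ∧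
    ∀ x ∈ L.support, 0 < f x

/-- The observation point `v_i + ε x_i`. -/
def obsPoint {d : ℕ} (v : ℕ → Fin d → ℕ) (ε : ℝ) (x : ℕ → EuclideanSpace ℝ (Fin d)) (i : ℕ) :
    EuclideanSpace ℝ (Fin d) :=
  WithLp.toLp 2 (fun k => (v i k : ℝ)) + ε • x i

/-- The set `D_ε = ⋃_{v ∈ ℤ^d, v ≠ 0} (v + ε C_S)`, where `C_S = {t₁ - t₂ : t₁, t₂ ∈ S}`. -/
def interpointSet {d : ℕ} (ε : ℝ) (S : Set (EuclideanSpace ℝ (Fin d))) :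
    Set (EuclideanSpace ℝ (Fin d)) :=
  {t | ∃ v : Fin d → ℤ, v ≠ 0 ∧ ∃ t₁ ∈ S, ∃ t₂ ∈ S,
    t = WithLp.toLp 2 (fun k => (v k : ℝ)) + ε • (t₁ - t₂)}

/-- `Y` is a centered Gaussian process on `ℝ^d` with covariance function `(s, t) ↦ k (s - t)`. -/
structure IsCenteredGaussianProcess {d : ℕ} {Ω : Type*} [MeasurableSpace Ω]
    (Y : EuclideanSpace ℝ (Fin d) → Ω → ℝ) (P : Measure Ω)
    (k : EuclideanSpace ℝ (Fin d) → ℝ) : Prop where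
  gaussian : IsGaussianProcess Y P
  centered : ∀ t, ∫ ω, Y t ω ∂P = 0
  covariance : ∀ s t, cov[Y s, Y t; P] = k (s - t)

/-! ### Leave-one-out Kriging and the cross validation criterion -/

/-- The covariance matrix `R_{i,j} = k (s_i - s_j)` of the observations at the points `s_i`. -/
def covMatrix {d n : ℕ} (k : EuclideanSpace ℝ (Fin d) → ℝ)
    (s : Fin n → EuclideanSpace ℝ (Fin d)) : Matrix (Fin n) (Fin n) ℝ :=
  Matrix.of fun i j => k (s i - s j)

/-- The (simple) Kriging prediction of the `i`-th coordinate of a centered Gaussian vector with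
covariance matrix `R` from its other coordinates `z`, that is `r_iᵀ R_{-i}⁻¹ z`, with `R_{-i}` the
matrix `R` without its `i`-th row and column and `r_i` the `i`-th row of `R` without its `i`-th
entry. It is the conditional mean: see `condExp_eq_krigingLOO`. -/
def krigingLOO {n : ℕ} (R : Matrix (Fin n) (Fin n) ℝ) (i : Fin n) (z : {j // j ≠ i} → ℝ) : ℝ :=
  (fun j : {j // j ≠ i} => R i j) ⬝ᵥ
    ((R.submatrix (fun j : {j // j ≠ i} => (j : Fin n)) (fun j : {j // j ≠ i} => (j : Fin n)))⁻¹
      *ᵥ z)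

/-- For a centered Gaussian vector `Z` with covariance matrix `R` (with `R_{-i}` invertible), the
Kriging prediction is the conditional expectation of `Z_i` given the `Z_j`, `j ≠ i`. -/
theorem condExp_eq_krigingLOO {n : ℕ} {Ω : Type*} [mΩ : MeasurableSpace Ω] (P : Measure Ω)
    [IsProbabilityMeasure P] (Z : Fin n → Ω → ℝ) (hZm : ∀ i, Measurable (Z i))
    (hZ : HasGaussianLaw (fun ω i => Z i ω) P) (hZ0 : ∀ i, ∫ ω, Z i ω ∂P = 0)
    (R : Matrix (Fin n) (Fin n) ℝ) (hR : ∀ i j, cov[Z i, Z j; P] = R i j) (i : Fin n)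
    (hdet : IsUnit (R.submatrix (fun j : {j // j ≠ i} => (j : Fin n))
      (fun j : {j // j ≠ i} => (j : Fin n))).det) :
    P[Z i | MeasurableSpace.comap (fun ω (j : {j // j ≠ i}) => Z j ω) inferInstance] =ᵐ[P]
      fun ω => krigingLOO R i (fun j => Z j ω) := by
  classical
  set A := R.submatrix (fun j : {j // j ≠ i} => (j : Fin n)) (fun j : {j // j ≠ i} => (j : Fin n))
    with hA
  -- the weights of the linear prediction
  set w : {j // j ≠ i} → ℝ := (fun j : {j // j ≠ i} => R i j) ᵥ* A⁻¹ with hw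
  have hpred : ∀ z : {j // j ≠ i} → ℝ, krigingLOO R i z = ∑ j, w j * z j := by
    intro z
    simp only [krigingLOO]
    rw [Matrix.dotProduct_mulVec]
    rfl
  have hwA : w ᵥ* A = fun j : {j // j ≠ i} => R i j := by
    rw [hw, Matrix.vecMul_vecMul, Matrix.nonsing_inv_mul _ hdet, Matrix.vecMul_one]
  have hL2 : ∀ j, MemLp (Z j) 2 P := fun j => (hZ.eval j).memLp_two
  set V : Ω → {j // j ≠ i} → ℝ := fun ω j => Z j ω with hV
  have hVm : Measurable V := measurable_pi_lambda _ fun j => hZm j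
  set W : Ω → ℝ := fun ω => Z i ω - ∑ j : {j // j ≠ i}, w j * Z j ω with hW
  have hWm : Measurable W :=
    (hZm i).sub (Finset.measurable_sum _ fun j _ => (hZm j).const_mul _)
  have hpm : Measurable[MeasurableSpace.comap V inferInstance]
      (fun ω => ∑ j : {j // j ≠ i}, w j * Z j ω) := by
    have h : Measurable (fun z : {j // j ≠ i} → ℝ => ∑ j, w j * z j) := by fun_prop
    exact h.comp (comap_measurable V)
  have hpi : Integrable (fun ω => ∑ j : {j // j ≠ i}, w j * Z j ω) P :=
    integrable_finsetSum _ fun j _ => ((hZ.eval j).integrable).const_mul _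
  have hWi : Integrable W P := (hZ.eval i).integrable.sub hpi
  -- joint Gaussianity and zero covariance give independence
  have hjoint : HasGaussianLaw (fun ω => ((fun _ : Unit => W ω), V ω)) P := by
    let T : (Fin n → ℝ) →ₗ[ℝ] (Unit → ℝ) × ({j // j ≠ i} → ℝ) :=
      { toFun := fun z => ((fun _ => z i - ∑ j : {j // j ≠ i}, w j * z j), fun j => z j)
        map_add' := by
          intro x y
          refine Prod.ext (funext fun _ => ?_) rfl
          simp only [Pi.add_apply, Prod.fst_add, mul_add, Finset.sum_add_distrib]
          ring
        map_smul' := by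
          intro c x
          refine Prod.ext (funext fun _ => ?_) rfl
          simp only [Pi.smul_apply, Prod.smul_fst, smul_eq_mul, RingHom.id_apply, mul_sub,
            Finset.mul_sum]
          congr 1
          exact Finset.sum_congr rfl fun j _ => by ring }
    exact hZ.map_fun T.toContinuousLinearMap
  have hcov : ∀ j : {j // j ≠ i}, cov[W, Z j; P] = 0 := by
    intro j
    have h1 : cov[W, Z j; P] = cov[Z i, Z j; P] -
        cov[fun ω => ∑ l : {j // j ≠ i}, w l * Z l ω, Z j; P] :=
      covariance_fun_sub_left (hL2 i)
        (memLp_finsetSum _ fun l _ => (hL2 l).const_mul _) (hL2 j)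
    rw [h1, covariance_fun_sum_left (X := fun (l : {j // j ≠ i}) ω => w l * Z l ω)
      (fun l => (hL2 l).const_mul _) (hL2 j)]
    simp only [covariance_const_mul_left, hR]
    have h2 := congrFun hwA j
    simp only [Matrix.vecMul, dotProduct, hA, Matrix.submatrix_apply] at h2
    rw [h2, sub_self]
  have hindep : IndepFun (fun ω (_ : Unit) => W ω) V P :=
    hjoint.indepFun_of_covariance_eval fun _ j => hcov j
  have hindep' : IndepFun W V P :=
    hindep.comp (φ := fun f : Unit → ℝ => f ()) (measurable_pi_apply _) measurable_id
  have hW0 : ∫ ω, W ω ∂P = 0 := by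
    rw [hW, integral_sub (hZ.eval i).integrable hpi, hZ0 i,
      integral_finsetSum (f := fun (j : {j // j ≠ i}) ω => w j * Z j ω) _
        fun j _ => ((hZ.eval j).integrable).const_mul _]
    simp [integral_const_mul, hZ0]
  have hce : P[W | MeasurableSpace.comap V inferInstance] =ᵐ[P] fun _ => (0 : ℝ) := by
    have h := condExp_indep_eq (μ := P) (f := W) hWm.comap_le hVm.comap_le
      (comap_measurable W).stronglyMeasurable hindep'
    rwa [hW0] at h
  have hdec : Z i = W + fun ω => ∑ j : {j // j ≠ i}, w j * Z j ω := by
    funext ω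
    simp [hW]
  have hadd := condExp_add hWi hpi (MeasurableSpace.comap V inferInstance)
  rw [← hdec, condExp_of_stronglyMeasurable hVm.comap_le hpm.stronglyMeasurable hpi] at hadd
  filter_upwards [hadd, hce] with ω h1 h2
  rw [h1, Pi.add_apply, h2, zero_add, hpred]

/-- The cross validation criterion: the sum of the squared leave-one-out Kriging errors
`∑ i, (y_i - ŷ_i(y_{-i}))²`, where the prediction uses the covariance function `k` at the
points `s_i`. -/
def cvCriterion {d n : ℕ} (k : EuclideanSpace ℝ (Fin d) → ℝ)
    (s : Fin n → EuclideanSpace ℝ (Fin d)) (y : Fin n → ℝ) : ℝ :=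
  ∑ i, (y i - krigingLOO (covMatrix k s) i (fun j => y j)) ^ 2

/-- `θhat n` is, for every sample size `n ≥ 1`, almost surely a global minimizer over `Θ` of the
cross validation criterion built from the observations `y_i = Y(v_i + ε X_i)`, `i < n`. The sample
space is the product of the one carrying the perturbations `X` and the one carrying `Y`. -/
def IsCVEstimator {d p : ℕ} {ΩX ΩY : Type*} [MeasurableSpace ΩX] [MeasurableSpace ΩY]
    (a b : ℝ) (K : (Fin p → ℝ) → EuclideanSpace ℝ (Fin d) → ℝ) (v : ℕ → Fin d → ℕ) (ε : ℝ)
    (PX : Measure ΩX) (X : ℕ → ΩX → EuclideanSpace ℝ (Fin d))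
    (PY : Measure ΩY) (Y : EuclideanSpace ℝ (Fin d) → ΩY → ℝ)
    (θhat : ℕ → ΩX × ΩY → Fin p → ℝ) : Prop :=
  ∀ n : ℕ, 1 ≤ n → ∀ᵐ ω ∂(PX.prod PY),
    θhat n ω ∈ paramCube p a b ∧
      ∀ θ ∈ paramCube p a b,
        cvCriterion (K (θhat n ω)) (fun i : Fin n => obsPoint v ε (fun j => X j ω.1) i)
            (fun i : Fin n => Y (obsPoint v ε (fun j => X j ω.1) i) ω.2) ≤
          cvCriterion (K θ) (fun i : Fin n => obsPoint v ε (fun j => X j ω.1) i)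
            (fun i : Fin n => Y (obsPoint v ε (fun j => X j ω.1) i) ω.2)

end

/-!
Let `R` be the covariance matrix of the observations `y`. By block inversion the leave-one-out
errors are the coordinates of `diag(R⁻¹)⁻¹ R⁻¹ y`, so the cross validation criterion is a quadratic
form in `y`. As the observation points are uniformly separated, the decay of `K_θ` and the
positivity of its Fourier transform put the spectra of all the matrices `R_θ` in one interval
`[l, u]`, `0 < l`.

Conditionally on the design, the expected excess of the criterion at `θ` over its value at `θ₀` is
then at least a constant times the squared Frobenius norm of `R_θ - R_{θ₀}` (this uses
`K_θ(0) = 1`: the criterion only sees `R` up to a scalar factor), while its variance is `O(n)`.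
If `K_θ` and `K_{θ₀}` differ at a possible difference `w + ε (t₁ - t₂)` of observation points, then
a positive proportion of the `n` points have a partner at lattice offset `w`, and a law of large
numbers for such pairs makes the Frobenius term of order `n`. Hence each `θ ≠ θ₀` loses to `θ₀` by
an amount of order `n`, and since the criterion is Lipschitz in `θ` with constant `O(n)`,
compactness makes this uniform away from `θ₀`.
-/

section MatrixNorms

open scoped Matrix.Norms.L2Operator

variable {m n k : Type*} [Fintype m] [Fintype n] [Fintype k]

/-- The squared Frobenius norm of a real matrix. It appears next to the operator norm, so it is
kept as a plain function instead of Mathlib's scoped norm instance. -/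
def frobSq (M : Matrix m n ℝ) : ℝ := ∑ i, ∑ j, M i j ^ 2

theorem frobSq_nonneg (M : Matrix m n ℝ) : 0 ≤ frobSq M :=
  Finset.sum_nonneg fun _ _ => Finset.sum_nonneg fun _ _ => sq_nonneg _

theorem frobSq_transpose (M : Matrix m n ℝ) : frobSq Mᵀ = frobSq M :=
  Finset.sum_comm

theorem frobSq_neg (M : Matrix m n ℝ) : frobSq (-M) = frobSq M := by
  simp only [frobSq, Matrix.neg_apply, neg_sq]

theorem frobSq_add_le (A B : Matrix m n ℝ) :
    frobSq (A + B) ≤ 2 * (frobSq A + frobSq B) := by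
  simp only [frobSq, Finset.mul_sum, ← Finset.sum_add_distrib, Matrix.add_apply]
  exact Finset.sum_le_sum fun i _ => Finset.sum_le_sum fun j _ => add_sq_le

theorem norm_toLp_sq_eq_dotProduct (x : m → ℝ) : ‖WithLp.toLp 2 x‖ ^ 2 = x ⬝ᵥ x := by
  simp only [EuclideanSpace.norm_sq_eq, dotProduct, Real.norm_eq_abs, sq_abs]
  simp only [sq]

theorem mulVec_dotProduct_mulVec_le [DecidableEq n] (M : Matrix m n ℝ) (x : n → ℝ) :
    (M *ᵥ x) ⬝ᵥ (M *ᵥ x) ≤ ‖M‖ ^ 2 * (x ⬝ᵥ x) := by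
  rw [← norm_toLp_sq_eq_dotProduct, ← norm_toLp_sq_eq_dotProduct, ← mul_pow]
  exact pow_le_pow_left₀ (norm_nonneg _) (M.l2_opNorm_mulVec (WithLp.toLp 2 x)) 2

theorem l2_opNorm_le_of_mulVec [DecidableEq n] {M : Matrix m n ℝ} {c : ℝ} (hc : 0 ≤ c)
    (h : ∀ x, (M *ᵥ x) ⬝ᵥ (M *ᵥ x) ≤ c ^ 2 * (x ⬝ᵥ x)) : ‖M‖ ≤ c := by
  rw [Matrix.l2_opNorm_def]
  refine ContinuousLinearMap.opNorm_le_bound _ hc fun x => ?_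
  have hx := h x.ofLp
  rw [← norm_toLp_sq_eq_dotProduct, ← norm_toLp_sq_eq_dotProduct, ← mul_pow] at hx
  exact le_of_sq_le_sq hx (by positivity)

theorem l2_opNorm_le_of_row_sum_of_col_sum [DecidableEq n] {M : Matrix m n ℝ} {c : ℝ} (hc : 0 ≤ c)
    (hrow : ∀ i, ∑ j, |M i j| ≤ c) (hcol : ∀ j, ∑ i, |M i j| ≤ c) : ‖M‖ ≤ c := by
  refine l2_opNorm_le_of_mulVec hc fun x => ?_
  have cauchySchwarz (i : m) : (M *ᵥ x) i ^ 2 ≤ (∑ j, |M i j|) * ∑ j, |M i j| * x j ^ 2 :=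
    Finset.sum_sq_le_sum_mul_sum_of_sq_le_mul _ (fun j _ => abs_nonneg _)
      (fun j _ => by positivity) fun j _ => by
        rw [mul_pow, ← sq_abs (M i j), sq |M i j|, mul_assoc]
  calc (M *ᵥ x) ⬝ᵥ (M *ᵥ x) = ∑ i, (M *ᵥ x) i ^ 2 := by simp only [dotProduct, sq]
    _ ≤ ∑ i, c * ∑ j, |M i j| * x j ^ 2 := Finset.sum_le_sum fun i _ =>
        (cauchySchwarz i).trans (mul_le_mul_of_nonneg_right (hrow i)
          (Finset.sum_nonneg fun j _ => by positivity))
    _ = c * ∑ j, (∑ i, |M i j|) * x j ^ 2 := by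
        rw [← Finset.mul_sum, Finset.sum_comm]
        simp only [Finset.sum_mul]
    _ ≤ c * ∑ j, c * x j ^ 2 := by
        gcongr with j _
        exact hcol j
    _ = c ^ 2 * (x ⬝ᵥ x) := by
        simp only [← Finset.mul_sum, dotProduct, sq, mul_assoc]

theorem frobSq_mul_le_left [DecidableEq n] (A : Matrix m n ℝ) (B : Matrix n k ℝ) :
    frobSq (A * B) ≤ ‖A‖ ^ 2 * frobSq B := by
  rw [← frobSq_transpose, ← frobSq_transpose B, frobSq, frobSq, Finset.mul_sum]
  refine Finset.sum_le_sum fun j _ => ?_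
  have h := mulVec_dotProduct_mulVec_le A (fun i => B i j)
  simp only [dotProduct, ← sq] at h
  exact h

theorem l2_opNorm_transpose [DecidableEq m] [DecidableEq n] (A : Matrix m n ℝ) : ‖Aᵀ‖ = ‖A‖ := by
  rw [← Matrix.l2_opNorm_conjTranspose A, Matrix.conjTranspose_eq_transpose_of_trivial]

theorem frobSq_mul_le_right [DecidableEq k] (A : Matrix m n ℝ) (B : Matrix n k ℝ) :
    frobSq (A * B) ≤ ‖B‖ ^ 2 * frobSq A := by
  classical
  rw [← frobSq_transpose, Matrix.transpose_mul, ← l2_opNorm_transpose B, ← frobSq_transpose A]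
  exact frobSq_mul_le_left _ _

theorem l2_opNorm_diagonal_le [DecidableEq n] {v : n → ℝ} {c : ℝ} (hc : 0 ≤ c)
    (h : ∀ i, |v i| ≤ c) :
    ‖(Matrix.diagonal v : Matrix n n ℝ)‖ ≤ c := by
  rw [Matrix.l2_opNorm_diagonal]
  exact (pi_norm_le_iff_of_nonneg hc).2 h

theorem abs_apply_le_l2_opNorm [DecidableEq n] (A : Matrix m n ℝ) (i : m) (j : n) :
    |A i j| ≤ ‖A‖ := by
  have h := A.l2_opNorm_mulVec (PiLp.single 2 j 1)
  simp only [PiLp.ofLp_single, Matrix.mulVec_single_one, PiLp.norm_single,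
    norm_one, mul_one] at h
  exact (PiLp.norm_apply_le (WithLp.toLp 2 (A.col j)) i).trans h

theorem abs_dotProduct_mulVec_le [DecidableEq n] (M : Matrix n n ℝ) (x : n → ℝ) :
    |x ⬝ᵥ M *ᵥ x| ≤ ‖M‖ * (x ⬝ᵥ x) := by
  have hCS := abs_real_inner_le_norm (WithLp.toLp 2 (M *ᵥ x)) (WithLp.toLp 2 x)
  rw [EuclideanSpace.inner_toLp_toLp] at hCS
  calc |x ⬝ᵥ M *ᵥ x| ≤ ‖WithLp.toLp 2 (M *ᵥ x)‖ * ‖WithLp.toLp 2 x‖ := by simpa using hCS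
    _ ≤ ‖M‖ * ‖WithLp.toLp 2 x‖ * ‖WithLp.toLp 2 x‖ := by
        gcongr
        exact M.l2_opNorm_mulVec (WithLp.toLp 2 x)
    _ = ‖M‖ * (x ⬝ᵥ x) := by rw [← norm_toLp_sq_eq_dotProduct]; ring

theorem norm_transpose_mul_self_sub_le [DecidableEq n] {A A' : Matrix m n ℝ} {α : ℝ}
    (hA : ‖A‖ ≤ α) (hA' : ‖A'‖ ≤ α) : ‖Aᵀ * A - A'ᵀ * A'‖ ≤ 2 * α * ‖A - A'‖ := by
  classical
  calc ‖Aᵀ * A - A'ᵀ * A'‖ = ‖Aᵀ * (A - A') + (A - A')ᵀ * A'‖ := by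
        rw [Matrix.transpose_sub, Matrix.mul_sub, Matrix.sub_mul, sub_add_sub_cancel]
    _ ≤ ‖Aᵀ‖ * ‖A - A'‖ + ‖(A - A')ᵀ‖ * ‖A'‖ :=
        (norm_add_le _ _).trans (add_le_add (Matrix.l2_opNorm_mul _ _) (Matrix.l2_opNorm_mul _ _))
    _ ≤ α * ‖A - A'‖ + ‖A - A'‖ * α := by
        rw [l2_opNorm_transpose, l2_opNorm_transpose]
        gcongr
    _ = 2 * α * ‖A - A'‖ := by ring

end MatrixNorms

section HasSpectrumIn

open scoped Matrix.Norms.L2Operator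

variable {m : Type*} [Fintype m] [DecidableEq m]

/-- `R` is a symmetric matrix whose eigenvalues lie in the compact interval `[l, u]` of positive
numbers. The upper bound is expressed by the operator norm. -/
structure HasSpectrumIn (R : Matrix m m ℝ) (l u : ℝ) : Prop where
  lower_pos : 0 < l
  lower_le_upper : l ≤ u
  symm : Rᵀ = R
  lower : ∀ x, l * (x ⬝ᵥ x) ≤ x ⬝ᵥ R *ᵥ x
  upper : ‖R‖ ≤ u

namespace HasSpectrumIn

variable {R R₀ : Matrix m m ℝ} {l u : ℝ}

theorem upper_pos (h : HasSpectrumIn R l u) : 0 < u :=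
  h.lower_pos.trans_le h.lower_le_upper

theorem posDef (h : HasSpectrumIn R l u) : R.PosDef := by
  refine Matrix.PosDef.of_dotProduct_mulVec_pos ?_ fun x hx => ?_
  · rw [Matrix.IsHermitian, Matrix.conjTranspose_eq_transpose_of_trivial, h.symm]
  · have hxx : 0 < x ⬝ᵥ x := by simpa using Matrix.dotProduct_star_self_pos_iff.2 hx
    exact (mul_pos h.lower_pos hxx).trans_le (h.lower x)

theorem isUnit_det (h : HasSpectrumIn R l u) : IsUnit R.det :=
  h.posDef.det_pos.ne'.isUnit

theorem mul_inv (h : HasSpectrumIn R l u) : R * R⁻¹ = 1 :=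
  Matrix.mul_nonsing_inv _ h.isUnit_det

theorem inv_mul (h : HasSpectrumIn R l u) : R⁻¹ * R = 1 :=
  Matrix.nonsing_inv_mul _ h.isUnit_det

theorem mulVec_inv_mulVec (h : HasSpectrumIn R l u) (x : m → ℝ) : R *ᵥ R⁻¹ *ᵥ x = x := by
  rw [Matrix.mulVec_mulVec, h.mul_inv, Matrix.one_mulVec]

theorem norm_inv_le (h : HasSpectrumIn R l u) : ‖R⁻¹‖ ≤ 1 / l := by
  refine Matrix.l2_opNorm_def R⁻¹ ▸ ContinuousLinearMap.opNorm_le_bound _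
    (one_div_nonneg.2 h.lower_pos.le) fun x => ?_
  set y := WithLp.toLp 2 (R⁻¹ *ᵥ x.ofLp)
  change ‖y‖ ≤ 1 / l * ‖x‖
  have hlower : l * ‖y‖ ^ 2 ≤ ‖x‖ * ‖y‖ := by
    rw [norm_toLp_sq_eq_dotProduct]
    refine (h.lower _).trans ?_
    rw [h.mulVec_inv_mulVec]
    exact real_inner_le_norm x y
  rw [div_mul_eq_mul_div, one_mul, le_div_iff₀ h.lower_pos]
  rcases (norm_nonneg y).eq_or_lt with hy | hy
  · rw [← hy, zero_mul]
    exact norm_nonneg x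
  · exact le_of_mul_le_mul_right (by linarith) hy

theorem le_inv_apply_self (h : HasSpectrumIn R l u) (i : m) : l / u ^ 2 ≤ R⁻¹ i i := by
  set y := R⁻¹ *ᵥ Pi.single i 1 with hy
  have hRy : R *ᵥ y = Pi.single i 1 := h.mulVec_inv_mulVec _
  have norm_ge : 1 ≤ u ^ 2 * (y ⬝ᵥ y) := by
    calc (1 : ℝ) = (R *ᵥ y) ⬝ᵥ (R *ᵥ y) := by
          rw [hRy, dotProduct_single_one, Pi.single_eq_same]
      _ ≤ ‖R‖ ^ 2 * (y ⬝ᵥ y) := mulVec_dotProduct_mulVec_le R y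
      _ ≤ u ^ 2 * (y ⬝ᵥ y) := by
          gcongr
          · exact Finset.sum_nonneg fun j _ => mul_self_nonneg _
          · exact h.upper
  have form_le : l * (y ⬝ᵥ y) ≤ R⁻¹ i i := by
    have hlower := h.lower y
    rwa [hRy, dotProduct_single_one, show y i = R⁻¹ i i by simp [hy]] at hlower
  have hu := h.upper_pos
  calc l / u ^ 2 ≤ l * (u ^ 2 * (y ⬝ᵥ y)) / u ^ 2 := by
        gcongr
        exact le_mul_of_one_le_right h.lower_pos.le norm_ge
    _ = l * (y ⬝ᵥ y) := by field_simp
    _ ≤ R⁻¹ i i := form_le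

theorem inv_apply_self_pos (h : HasSpectrumIn R l u) (i : m) : 0 < R⁻¹ i i :=
  (div_pos h.lower_pos (pow_pos h.upper_pos 2)).trans_le (h.le_inv_apply_self i)

theorem inv_apply_self_le (h : HasSpectrumIn R l u) (i : m) : R⁻¹ i i ≤ 1 / l :=
  (le_abs_self _).trans ((abs_apply_le_l2_opNorm R⁻¹ i i).trans h.norm_inv_le)

theorem inv_inv_apply_self_le (h : HasSpectrumIn R l u) (i : m) : (R⁻¹ i i)⁻¹ ≤ u ^ 2 / l := by
  rw [inv_le_comm₀ (h.inv_apply_self_pos i) (div_pos (pow_pos h.upper_pos 2) h.lower_pos), inv_div]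
  exact h.le_inv_apply_self i

theorem norm_inv_sub_inv_le (h : HasSpectrumIn R l u) (h₀ : HasSpectrumIn R₀ l u) :
    ‖R⁻¹ - R₀⁻¹‖ ≤ 1 / l ^ 2 * ‖R - R₀‖ := by
  have hl := h.lower_pos
  calc ‖R⁻¹ - R₀⁻¹‖ = ‖R⁻¹ * (R₀ - R) * R₀⁻¹‖ := by
        rw [mul_sub, sub_mul, h.inv_mul, mul_assoc, h₀.mul_inv, one_mul, mul_one]
    _ ≤ ‖R⁻¹‖ * ‖R₀ - R‖ * ‖R₀⁻¹‖ := norm_mul₃_le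
    _ ≤ 1 / l * ‖R₀ - R‖ * (1 / l) := by
        gcongr
        exacts [h.norm_inv_le, h₀.norm_inv_le]
    _ = 1 / l ^ 2 * ‖R - R₀‖ := by
        rw [norm_sub_rev]
        field_simp

end HasSpectrumIn

end HasSpectrumIn

section LeaveOneOut

open scoped Matrix.Norms.L2Operator

variable {m : Type*} [Fintype m] [DecidableEq m]

/-- The inverse of the diagonal part of `R⁻¹`: for a covariance matrix `R`, the diagonal matrix of
the variances of the leave-one-out prediction errors. -/
noncomputable def looDiag (R : Matrix m m ℝ) : Matrix m m ℝ :=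
  Matrix.diagonal fun i => (R⁻¹ i i)⁻¹

/-- The matrix that maps a vector of observations with covariance matrix `R` to the vector of its
leave-one-out prediction errors, see `HasSpectrumIn.sub_krigingLOO`. -/
noncomputable def looMatrix (R : Matrix m m ℝ) : Matrix m m ℝ := looDiag R * R⁻¹

namespace HasSpectrumIn

variable {R R₀ : Matrix m m ℝ} {l u : ℝ}

theorem norm_looDiag_le (h : HasSpectrumIn R l u) : ‖looDiag R‖ ≤ u ^ 2 / l := by
  refine l2_opNorm_diagonal_le (div_nonneg (sq_nonneg u) h.lower_pos.le) fun i => ?_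
  rw [abs_of_pos (inv_pos.2 (h.inv_apply_self_pos i))]
  exact h.inv_inv_apply_self_le i

theorem norm_looMatrix_le (h : HasSpectrumIn R l u) : ‖looMatrix R‖ ≤ u ^ 2 / l ^ 2 := by
  have hl := h.lower_pos
  calc ‖looMatrix R‖ ≤ ‖looDiag R‖ * ‖R⁻¹‖ := norm_mul_le _ _
    _ ≤ (u ^ 2 / l) * (1 / l) := by
        gcongr
        exacts [h.norm_looDiag_le, h.norm_inv_le]
    _ = u ^ 2 / l ^ 2 := by field_simp

theorem norm_looDiag_sub_le (h : HasSpectrumIn R l u) (h₀ : HasSpectrumIn R₀ l u) :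
    ‖looDiag R - looDiag R₀‖ ≤ u ^ 4 / l ^ 4 * ‖R - R₀‖ := by
  have hl := h.lower_pos
  rw [looDiag, looDiag, Matrix.diagonal_sub]
  refine l2_opNorm_diagonal_le (by positivity) fun i => ?_
  have hi := h.inv_apply_self_pos i
  have hi₀ := h₀.inv_apply_self_pos i
  calc |(R⁻¹ i i)⁻¹ - (R₀⁻¹ i i)⁻¹|
      = (R⁻¹ i i)⁻¹ * (R₀⁻¹ i i)⁻¹ * |(R₀⁻¹ - R⁻¹) i i| := by
        rw [inv_sub_inv hi.ne' hi₀.ne', abs_div, abs_of_pos (mul_pos hi hi₀), Matrix.sub_apply,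
          div_eq_inv_mul, mul_inv_rev, mul_comm (R₀⁻¹ i i)⁻¹]
    _ ≤ (u ^ 2 / l) * (u ^ 2 / l) * (1 / l ^ 2 * ‖R - R₀‖) := by
        gcongr
        · exact h.inv_inv_apply_self_le i
        · exact h₀.inv_inv_apply_self_le i
        · rw [norm_sub_rev]
          exact (abs_apply_le_l2_opNorm _ i i).trans (h₀.norm_inv_sub_inv_le h)
    _ = u ^ 4 / l ^ 4 * ‖R - R₀‖ := by field_simp

theorem norm_looMatrix_sub_le (h : HasSpectrumIn R l u) (h₀ : HasSpectrumIn R₀ l u) :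
    ‖looMatrix R - looMatrix R₀‖ ≤ (u ^ 2 / l ^ 3 + u ^ 4 / l ^ 5) * ‖R - R₀‖ := by
  have hl := h.lower_pos
  calc ‖looMatrix R - looMatrix R₀‖
      = ‖looDiag R * (R⁻¹ - R₀⁻¹) + (looDiag R - looDiag R₀) * R₀⁻¹‖ := by
        rw [mul_sub, sub_mul, looMatrix, looMatrix, sub_add_sub_cancel]
    _ ≤ ‖looDiag R‖ * ‖R⁻¹ - R₀⁻¹‖ + ‖looDiag R - looDiag R₀‖ * ‖R₀⁻¹‖ :=
        (norm_add_le _ _).trans (add_le_add (norm_mul_le _ _) (norm_mul_le _ _))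
    _ ≤ u ^ 2 / l * (1 / l ^ 2 * ‖R - R₀‖) + u ^ 4 / l ^ 4 * ‖R - R₀‖ * (1 / l) := by
        gcongr
        exacts [h.norm_looDiag_le, h.norm_inv_sub_inv_le h₀, h.norm_looDiag_sub_le h₀,
          h₀.norm_inv_le]
    _ = (u ^ 2 / l ^ 3 + u ^ 4 / l ^ 5) * ‖R - R₀‖ := by field_simp

theorem looMatrix_mul (h : HasSpectrumIn R l u) : looMatrix R * R = looDiag R := by
  rw [looMatrix, mul_assoc, h.inv_mul, mul_one]

theorem mul_transpose_looMatrix (h : HasSpectrumIn R l u) : R * (looMatrix R)ᵀ = looDiag R := by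
  have hT := congrArg Matrix.transpose h.looMatrix_mul
  rwa [Matrix.transpose_mul, h.symm, looDiag, Matrix.diagonal_transpose] at hT

theorem looMatrix_apply_self (h : HasSpectrumIn R l u) (i : m) : looMatrix R i i = 1 := by
  rw [looMatrix, looDiag, Matrix.diagonal_mul, inv_mul_cancel₀ (h.inv_apply_self_pos i).ne']

theorem sub_mul_diagonal_eq (h : HasSpectrumIn R l u) (h₀ : HasSpectrumIn R₀ l u) :
    R - R₀ * Matrix.diagonal (fun i => R₀⁻¹ i i * (R⁻¹ i i)⁻¹) =
      R₀ * Matrix.diagonal (fun i => R₀⁻¹ i i) * (looMatrix R₀ - looMatrix R) * R := by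
  set D := Matrix.diagonal fun i => R₀⁻¹ i i with hD
  have hD₀ : D * looDiag R₀ = 1 := by
    rw [hD, looDiag, Matrix.diagonal_mul_diagonal, ← Matrix.diagonal_one]
    congr 1 with i
    exact mul_inv_cancel₀ (h₀.inv_apply_self_pos i).ne'
  rw [mul_sub, sub_mul, mul_assoc _ (looMatrix R), h.looMatrix_mul, looMatrix,
    ← mul_assoc (R₀ * D), mul_assoc R₀ D, hD₀, mul_one, h₀.mul_inv, one_mul, mul_assoc, looDiag,
    hD, Matrix.diagonal_mul_diagonal]

theorem frobSq_sub_mul_diagonal_le (h : HasSpectrumIn R l u) (h₀ : HasSpectrumIn R₀ l u) :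
    frobSq (R - R₀ * Matrix.diagonal fun i => R₀⁻¹ i i * (R⁻¹ i i)⁻¹) ≤
      (u ^ 2 / l) ^ 2 * frobSq (looMatrix R - looMatrix R₀) := by
  have hl := h.lower_pos
  have hu := h.upper_pos
  set D := Matrix.diagonal fun i => R₀⁻¹ i i
  have norm_le : ‖R₀ * D‖ ≤ u * (1 / l) := by
    refine (norm_mul_le _ _).trans (mul_le_mul h₀.upper ?_ (norm_nonneg _) hu.le)
    refine l2_opNorm_diagonal_le (by positivity) fun i => ?_
    rw [abs_of_pos (h₀.inv_apply_self_pos i)]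
    exact h₀.inv_apply_self_le i
  rw [h.sub_mul_diagonal_eq h₀]
  calc frobSq (R₀ * D * (looMatrix R₀ - looMatrix R) * R)
      ≤ ‖R‖ ^ 2 * (‖R₀ * D‖ ^ 2 * frobSq (looMatrix R₀ - looMatrix R)) :=
        (frobSq_mul_le_right _ _).trans
          (mul_le_mul_of_nonneg_left (frobSq_mul_le_left _ _) (sq_nonneg _))
    _ ≤ u ^ 2 * ((u * (1 / l)) ^ 2 * frobSq (looMatrix R₀ - looMatrix R)) := by
        have := frobSq_nonneg (looMatrix R₀ - looMatrix R)
        gcongr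
        exact h.upper
    _ = (u ^ 2 / l) ^ 2 * frobSq (looMatrix R - looMatrix R₀) := by
        rw [← frobSq_neg, neg_sub]
        ring

end HasSpectrumIn

/-- When `R` and `R₀` have unit diagonals, the diagonal of `R - R₀ * T` is that of `1 - T`. -/
theorem frobSq_diagonal_sub_one_le {R R₀ : Matrix m m ℝ} (hR : ∀ i, R i i = 1)
    (hR₀ : ∀ i, R₀ i i = 1) (w : m → ℝ) :
    frobSq (Matrix.diagonal w - 1) ≤ frobSq (R - R₀ * Matrix.diagonal w) := by
  refine Finset.sum_le_sum fun i _ => ?_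
  calc ∑ j, (Matrix.diagonal w - 1) i j ^ 2 = (Matrix.diagonal w - 1) i i ^ 2 :=
        Finset.sum_eq_single_of_mem i (Finset.mem_univ i) fun j _ hj => by
          rw [Matrix.sub_apply, Matrix.diagonal_apply_ne' _ hj, Matrix.one_apply_ne' hj, sub_zero,
            zero_pow two_ne_zero]
    _ = (R - R₀ * Matrix.diagonal w) i i ^ 2 := by
        rw [Matrix.sub_apply, Matrix.sub_apply, Matrix.mul_diagonal, Matrix.diagonal_apply_eq,
          Matrix.one_apply_eq, hR, hR₀, one_mul]
        ring
    _ ≤ ∑ j, (R - R₀ * Matrix.diagonal w) i j ^ 2 :=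
        Finset.single_le_sum (f := fun j => (R - R₀ * Matrix.diagonal w) i j ^ 2)
          (fun j _ => sq_nonneg _) (Finset.mem_univ i)

namespace HasSpectrumIn

variable {R R₀ : Matrix m m ℝ} {l u : ℝ}

theorem frobSq_sub_le (h : HasSpectrumIn R l u) (h₀ : HasSpectrumIn R₀ l u)
    (hR : ∀ i, R i i = 1) (hR₀ : ∀ i, R₀ i i = 1) :
    frobSq (R - R₀) ≤
      2 * (1 + u ^ 2) * (u ^ 2 / l) ^ 2 * frobSq (looMatrix R - looMatrix R₀) := by
  set T := Matrix.diagonal fun i => R₀⁻¹ i i * (R⁻¹ i i)⁻¹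
  have frobSq_mul_sub_one_le : frobSq (R₀ * (T - 1)) ≤ u ^ 2 * frobSq (R - R₀ * T) :=
    calc frobSq (R₀ * (T - 1)) ≤ ‖R₀‖ ^ 2 * frobSq (T - 1) := frobSq_mul_le_left _ _
      _ ≤ u ^ 2 * frobSq (R - R₀ * T) := by
          gcongr
          · exact frobSq_nonneg _
          · exact h₀.upper
          · exact frobSq_diagonal_sub_one_le hR hR₀ _
  calc frobSq (R - R₀) = frobSq ((R - R₀ * T) + R₀ * (T - 1)) := by
        rw [mul_sub, mul_one, sub_add_sub_cancel]
    _ ≤ 2 * (frobSq (R - R₀ * T) + u ^ 2 * frobSq (R - R₀ * T)) :=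
        (frobSq_add_le _ _).trans (by gcongr)
    _ ≤ 2 * ((u ^ 2 / l) ^ 2 * frobSq (looMatrix R - looMatrix R₀) +
          u ^ 2 * ((u ^ 2 / l) ^ 2 * frobSq (looMatrix R - looMatrix R₀))) := by
        gcongr <;> exact h.frobSq_sub_mul_diagonal_le h₀
    _ = 2 * (1 + u ^ 2) * (u ^ 2 / l) ^ 2 * frobSq (looMatrix R - looMatrix R₀) := by ring

theorem frobSq_le_trace (h : HasSpectrumIn R l u) (D : Matrix m m ℝ) :
    l * frobSq D ≤ (D * R * Dᵀ).trace := by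
  rw [Matrix.trace, frobSq, Finset.mul_sum]
  refine Finset.sum_le_sum fun i _ => ?_
  calc l * ∑ j, D i j ^ 2 = l * (D i ⬝ᵥ D i) := by simp only [dotProduct, sq]
    _ ≤ D i ⬝ᵥ R *ᵥ D i := h.lower (D i)
    _ = (D * R * Dᵀ).diag i := by
        rw [mul_assoc]
        rfl

theorem trace_sub_mul_transpose_looMatrix (h : HasSpectrumIn R l u) (h₀ : HasSpectrumIn R₀ l u) :
    ((looMatrix R - looMatrix R₀) * R₀ * (looMatrix R₀)ᵀ).trace = 0 := by
  rw [mul_assoc, h₀.mul_transpose_looMatrix, looDiag, Matrix.trace]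
  exact Finset.sum_eq_zero fun i _ => by
    rw [Matrix.diag_apply, Matrix.mul_diagonal, Matrix.sub_apply, h.looMatrix_apply_self,
      h₀.looMatrix_apply_self, sub_self, zero_mul]

/-- The right side is the excess of the expected criterion when the true covariance is `R₀`. The
cross terms vanish because `R₀ * (looMatrix R₀)ᵀ` is diagonal while the two residual matrices have
the same diagonal. -/
theorem frobSq_looMatrix_sub_le (h : HasSpectrumIn R l u) (h₀ : HasSpectrumIn R₀ l u) :
    l * frobSq (looMatrix R - looMatrix R₀) ≤
      (((looMatrix R)ᵀ * looMatrix R - (looMatrix R₀)ᵀ * looMatrix R₀) * R₀).trace := by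
  set A := looMatrix R
  set A₀ := looMatrix R₀
  have cross : ((A - A₀) * R₀ * A₀ᵀ).trace = 0 := h.trace_sub_mul_transpose_looMatrix h₀
  have cross_transpose : (A₀ * R₀ * (A - A₀)ᵀ).trace = 0 := by
    rw [← Matrix.trace_transpose, Matrix.transpose_mul, Matrix.transpose_transpose,
      Matrix.transpose_mul, h₀.symm, ← mul_assoc, cross]
  refine (h₀.frobSq_le_trace (A - A₀)).trans_eq ?_
  calc ((A - A₀) * R₀ * (A - A₀)ᵀ).trace
      = ((A - A₀) * R₀ * (A - A₀)ᵀ + (A - A₀) * R₀ * A₀ᵀ + A₀ * R₀ * (A - A₀)ᵀ).trace := by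
        rw [Matrix.trace_add, Matrix.trace_add, cross, cross_transpose, add_zero, add_zero]
    _ = (A * R₀ * Aᵀ - A₀ * R₀ * A₀ᵀ).trace := by
        rw [Matrix.transpose_sub]
        congr 1
        noncomm_ring
    _ = ((Aᵀ * A - A₀ᵀ * A₀) * R₀).trace := by
        rw [sub_mul, Matrix.trace_sub, Matrix.trace_sub, Matrix.trace_mul_comm _ Aᵀ,
          Matrix.trace_mul_comm _ A₀ᵀ, ← mul_assoc, ← mul_assoc]

theorem looMatrix_mulVec_apply (h : HasSpectrumIn R l u) (y : m → ℝ) (i : m) :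
    (looMatrix R *ᵥ y) i = y i + ∑ j : {j // j ≠ i}, looMatrix R i j * y j := by
  rw [Matrix.mulVec, dotProduct, ← Finset.add_sum_erase _ _ (Finset.mem_univ i),
    h.looMatrix_apply_self, one_mul]
  congr 1
  exact Finset.sum_subtype _ (fun j => by simp) fun j => looMatrix R i j * y j

theorem sum_looMatrix_mul_eq_neg (h : HasSpectrumIn R l u) {i j : m} (hij : j ≠ i) :
    ∑ k : {k // k ≠ i}, looMatrix R i k * R k j = -R i j := by
  have offdiag : (looMatrix R *ᵥ (fun k => R k j)) i = 0 := by
    rw [← Matrix.diagonal_apply_ne' (fun i => (R⁻¹ i i)⁻¹) hij, ← looDiag, ← h.looMatrix_mul]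
    rfl
  rw [h.looMatrix_mulVec_apply] at offdiag
  exact eq_neg_of_add_eq_zero_right offdiag

theorem sub_krigingLOO {n : ℕ} {R : Matrix (Fin n) (Fin n) ℝ} (h : HasSpectrumIn R l u)
    (y : Fin n → ℝ) (i : Fin n) :
    y i - krigingLOO R i (fun j => y j) = (looMatrix R *ᵥ y) i := by
  set B := R.submatrix (fun j : {j // j ≠ i} => (j : Fin n)) (fun j : {j // j ≠ i} => (j : Fin n))
  have hB : IsUnit B.det := (h.posDef.submatrix Subtype.val_injective).det_pos.ne'.isUnit
  have row_eq :
      (fun k : {k // k ≠ i} => -looMatrix R i k) ᵥ* B = fun j : {j // j ≠ i} => R i j := by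
    funext j
    simp only [B, Matrix.vecMul, dotProduct, Matrix.submatrix_apply, neg_mul,
      Finset.sum_neg_distrib, h.sum_looMatrix_mul_eq_neg j.2, neg_neg]
  rw [krigingLOO, ← row_eq, Matrix.dotProduct_mulVec, Matrix.vecMul_vecMul,
    Matrix.mul_nonsing_inv _ hB, Matrix.vecMul_one, h.looMatrix_mulVec_apply]
  simp only [dotProduct, neg_mul, Finset.sum_neg_distrib, sub_neg_eq_add]

end HasSpectrumIn

end LeaveOneOut

section Criterion

open scoped Matrix.Norms.L2Operator

namespace HasSpectrumIn

variable {d n : ℕ} {k k' : EuclideanSpace ℝ (Fin d) → ℝ} {s : Fin n → EuclideanSpace ℝ (Fin d)}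
  {l u : ℝ}

theorem cvCriterion_eq (h : HasSpectrumIn (covMatrix k s) l u) (y : Fin n → ℝ) :
    cvCriterion k s y =
      y ⬝ᵥ ((looMatrix (covMatrix k s))ᵀ * looMatrix (covMatrix k s)) *ᵥ y := by
  rw [← Matrix.mulVec_mulVec, Matrix.dotProduct_mulVec, Matrix.vecMul_transpose]
  simp only [cvCriterion, h.sub_krigingLOO, dotProduct, sq]

theorem cvCriterion_sub_eq (h : HasSpectrumIn (covMatrix k s) l u)
    (h' : HasSpectrumIn (covMatrix k' s) l u) (y : Fin n → ℝ) :
    cvCriterion k s y - cvCriterion k' s y =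
      y ⬝ᵥ ((looMatrix (covMatrix k s))ᵀ * looMatrix (covMatrix k s) -
        (looMatrix (covMatrix k' s))ᵀ * looMatrix (covMatrix k' s)) *ᵥ y := by
  rw [h.cvCriterion_eq, h'.cvCriterion_eq, Matrix.sub_mulVec, dotProduct_sub]

theorem abs_cvCriterion_sub_le (h : HasSpectrumIn (covMatrix k s) l u)
    (h' : HasSpectrumIn (covMatrix k' s) l u) (y : Fin n → ℝ) :
    |cvCriterion k s y - cvCriterion k' s y| ≤
      2 * (u ^ 2 / l ^ 2) * (u ^ 2 / l ^ 3 + u ^ 4 / l ^ 5) *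
        ‖covMatrix k s - covMatrix k' s‖ * (y ⬝ᵥ y) := by
  rw [h.cvCriterion_sub_eq h', mul_assoc (2 * (u ^ 2 / l ^ 2))]
  refine (abs_dotProduct_mulVec_le _ _).trans (mul_le_mul_of_nonneg_right ?_
    (Finset.sum_nonneg fun i _ => mul_self_nonneg _))
  refine (norm_transpose_mul_self_sub_le h.norm_looMatrix_le h'.norm_looMatrix_le).trans ?_
  gcongr
  exact h.norm_looMatrix_sub_le h'

end HasSpectrumIn

end Criterion

section SeparatedFamilies

/-- The points `s i` are at mutual distance at least `δ`. -/
def IsSeparatedFamily {ι E : Type*} [NormedAddCommGroup E] (δ : ℝ) (s : ι → E) : Prop :=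
  ∀ i j, i ≠ j → δ ≤ ‖s i - s j‖

namespace IsSeparatedFamily

variable {ι E : Type*} [NormedAddCommGroup E] {δ : ℝ} {s : ι → E}

theorem const_sub (hs : IsSeparatedFamily δ s) (x : E) : IsSeparatedFamily δ fun i => x - s i :=
  fun i j hij => by
    rw [sub_sub_sub_cancel_left, norm_sub_rev]
    exact hs i j hij

theorem pairwise_disjoint_ball (hs : IsSeparatedFamily δ s) :
    Pairwise (Function.onFun Disjoint fun i => Metric.ball (s i) (δ / 2)) := fun i j hij =>
  Metric.ball_disjoint_ball (by rw [add_halves, dist_eq_norm]; exact hs i j hij)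

theorem measure_ball_mul_sum_le_integral [Fintype ι] [ProperSpace E] [MeasurableSpace E]
    [BorelSpace E] {μ : Measure E} [μ.IsAddHaarMeasure] (hs : IsSeparatedFamily δ s) {F : E → ℝ}
    (hF : Integrable F μ) (hF_nonneg : ∀ t, 0 ≤ F t) {c : ℝ} (hc : 0 ≤ c)
    (hFc : ∀ t t', ‖t' - t‖ < δ / 2 → F t ≤ c * F t') :
    μ.real (Metric.ball 0 (δ / 2)) * ∑ i, F (s i) ≤ c * ∫ t, F t ∂μ := by
  have le_setIntegral (i : ι) :
      μ.real (Metric.ball 0 (δ / 2)) * F (s i) ≤ c * ∫ t in Metric.ball (s i) (δ / 2), F t ∂μ :=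
    calc μ.real (Metric.ball 0 (δ / 2)) * F (s i)
        = ∫ _ in Metric.ball (s i) (δ / 2), F (s i) ∂μ := by
          rw [setIntegral_const, smul_eq_mul, measureReal_def, measureReal_def,
            Measure.addHaar_ball_center μ (s i)]
      _ ≤ ∫ t in Metric.ball (s i) (δ / 2), c * F t ∂μ :=
          setIntegral_mono_on (integrableOn_const measure_ball_lt_top.ne)
            (hF.const_mul c).integrableOn measurableSet_ball fun t ht =>
              hFc _ _ (by rwa [← dist_eq_norm])
      _ = c * ∫ t in Metric.ball (s i) (δ / 2), F t ∂μ := integral_const_mul _ _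
  calc μ.real (Metric.ball 0 (δ / 2)) * ∑ i, F (s i)
      ≤ c * ∑ i, ∫ t in Metric.ball (s i) (δ / 2), F t ∂μ := by
        rw [Finset.mul_sum, Finset.mul_sum]
        exact Finset.sum_le_sum fun i _ => le_setIntegral i
    _ = c * ∫ t in ⋃ i, Metric.ball (s i) (δ / 2), F t ∂μ := by
        rw [integral_iUnion_fintype (fun _ => measurableSet_ball) hs.pairwise_disjoint_ball
          fun _ => hF.integrableOn]
    _ ≤ c * ∫ t, F t ∂μ :=
        mul_le_mul_of_nonneg_left (setIntegral_le_integral hF (ae_of_all _ hF_nonneg)) hc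

end IsSeparatedFamily

variable {E : Type*} [NormedAddCommGroup E]

theorem inv_one_add_norm_pow_le {ρ : ℝ} {t t' : E} (h : ‖t' - t‖ < ρ) (r : ℕ) :
    ((1 + ‖t‖) ^ r)⁻¹ ≤ (1 + ρ) ^ r * ((1 + ‖t'‖) ^ r)⁻¹ := by
  have hρ : 0 < ρ := (norm_nonneg _).trans_lt h
  have htri : ‖t'‖ ≤ ‖t‖ + ρ := by linarith [norm_le_norm_add_norm_sub' t' t]
  rw [← div_eq_mul_inv, inv_le_iff_one_le_mul₀ (by positivity), div_mul_eq_mul_div,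
    one_le_div (by positivity), ← mul_pow]
  gcongr
  nlinarith [mul_nonneg hρ.le (norm_nonneg t)]

theorem one_div_one_add_norm_pow_le (t : E) (r : ℕ) :
    1 / (1 + ‖t‖ ^ r) ≤ 2 ^ (r - 1) * ((1 + ‖t‖) ^ r)⁻¹ := by
  have h := add_pow_le zero_le_one (norm_nonneg t) r
  rw [one_pow] at h
  rw [← div_eq_mul_inv, div_le_div_iff₀ (by positivity) (by positivity), one_mul]
  exact h

theorem exists_sum_separated_le (E : Type*) [NormedAddCommGroup E] [NormedSpace ℝ E]
    [FiniteDimensional ℝ E] {δ : ℝ} (hδ : 0 < δ) {r : ℕ} (hr : Module.finrank ℝ E < r) :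
    ∃ Λ : ℝ, 0 < Λ ∧ ∀ {ι : Type*} [Fintype ι] {s : ι → E}, IsSeparatedFamily δ s →
      ∀ x, ∑ j, 1 / (1 + ‖x - s j‖ ^ r) ≤ Λ := by
  borelize E
  let μ : Measure E := Measure.addHaar
  let F : E → ℝ := fun t => ((1 + ‖t‖) ^ r)⁻¹
  have hF : Integrable F μ := by
    simpa only [Real.rpow_neg (add_nonneg zero_le_one (norm_nonneg _)), Real.rpow_natCast] using
      integrable_one_add_norm (μ := μ) (r := (r : ℝ)) (by exact_mod_cast hr)
  have hF_nonneg : ∀ t, 0 ≤ F t := fun t => by positivity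
  set b := μ.real (Metric.ball 0 (δ / 2))
  have hb : 0 < b :=
    ENNReal.toReal_pos (Metric.measure_ball_pos _ _ (half_pos hδ)).ne' measure_ball_lt_top.ne
  set I := (1 + δ / 2) ^ r * ∫ t, F t ∂μ
  have : 0 ≤ I := mul_nonneg (by positivity) (integral_nonneg hF_nonneg)
  refine ⟨2 ^ (r - 1) * (I / b) + 1, by positivity, fun {ι} _ s hs x => ?_⟩
  have packing : b * ∑ j, F (x - s j) ≤ I :=
    (hs.const_sub x).measure_ball_mul_sum_le_integral hF hF_nonneg (by positivity)
      fun _ _ h => inv_one_add_norm_pow_le h r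
  calc ∑ j, 1 / (1 + ‖x - s j‖ ^ r) ≤ 2 ^ (r - 1) * ∑ j, F (x - s j) := by
        rw [Finset.mul_sum]
        exact Finset.sum_le_sum fun j _ => one_div_one_add_norm_pow_le _ r
    _ ≤ 2 ^ (r - 1) * (I / b) := by
        gcongr
        rwa [le_div_iff₀' hb]
    _ ≤ 2 ^ (r - 1) * (I / b) + 1 := le_add_of_nonneg_right zero_le_one

end SeparatedFamilies

section CosineTransform

variable {E : Type*} [NormedAddCommGroup E] [InnerProductSpace ℝ E]

/-- The cosine transform `t ↦ ∫ κ(f) cos(f·t) df`, that is the Fourier transform of the even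
part of `κ`. It turns the spectral density of a stationary process into its covariance function. -/
noncomputable def cosTransform [MeasurableSpace E] (μ : Measure E) (κ : E → ℝ) (t : E) : ℝ :=
  ∫ f, κ f * Real.cos (inner ℝ f t) ∂μ

/-- The squared modulus of the exponential sum `∑ j, c j exp (i f·s j)`. -/
noncomputable def expSumSq {ι : Type*} [Fintype ι] (s : ι → E) (c : ι → ℝ) (f : E) : ℝ :=
  (∑ i, c i * Real.cos (inner ℝ f (s i))) ^ 2 + (∑ i, c i * Real.sin (inner ℝ f (s i))) ^ 2

theorem expSumSq_nonneg {ι : Type*} [Fintype ι] (s : ι → E) (c : ι → ℝ) (f : E) :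
    0 ≤ expSumSq s c f := by
  unfold expSumSq
  positivity

theorem expSumSq_eq {ι : Type*} [Fintype ι] (s : ι → E) (c : ι → ℝ) (f : E) :
    expSumSq s c f = ∑ i, ∑ j, c i * c j * Real.cos (inner ℝ f (s i - s j)) := by
  simp only [expSumSq, sq, Finset.sum_mul_sum, ← Finset.sum_add_distrib, inner_sub_right,
    Real.cos_sub]
  exact Finset.sum_congr rfl fun i _ => Finset.sum_congr rfl fun j _ => by ring

variable [MeasurableSpace E]

theorem cosTransform_neg (μ : Measure E) (κ : E → ℝ) (t : E) :
    cosTransform μ κ (-t) = cosTransform μ κ t := by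
  simp only [cosTransform, inner_neg_right, Real.cos_neg]

theorem cosTransform_zero (μ : Measure E) (κ : E → ℝ) : cosTransform μ κ 0 = ∫ f, κ f ∂μ := by
  simp only [cosTransform, inner_zero_right, Real.cos_zero, mul_one]

variable [BorelSpace E] {μ : Measure E} {κ : E → ℝ}

theorem integrable_mul_cos_inner (hκ : Integrable κ μ) (t : E) :
    Integrable (fun f => κ f * Real.cos (inner ℝ f t)) μ :=
  hκ.mul_bdd (c := 1) (Real.continuous_cos.comp (by fun_prop)).aestronglyMeasurable
    (ae_of_all _ fun _ => Real.abs_cos_le_one _)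

theorem continuous_cosTransform (hκ : Integrable κ μ) : Continuous (cosTransform μ κ) :=
  continuous_of_dominated (bound := fun f => ‖κ f‖)
    (fun t => (integrable_mul_cos_inner hκ t).aestronglyMeasurable)
    (fun t => ae_of_all _ fun f => by
      rw [norm_mul]
      exact mul_le_of_le_one_right (norm_nonneg _) (Real.abs_cos_le_one _))
    hκ.norm (ae_of_all _ fun f => by fun_prop)

theorem integrable_mul_expSumSq {ι : Type*} [Fintype ι] (hκ : Integrable κ μ) (s : ι → E)
    (c : ι → ℝ) : Integrable (fun f => κ f * expSumSq s c f) μ := by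
  simp only [expSumSq_eq, Finset.mul_sum, mul_left_comm (κ _)]
  exact integrable_finsetSum _ fun i _ => integrable_finsetSum _ fun j _ =>
    (integrable_mul_cos_inner hκ (s i - s j)).const_mul (c i * c j)

theorem dotProduct_cosTransform_mulVec {ι : Type*} [Fintype ι] (hκ : Integrable κ μ) (s : ι → E)
    (c : ι → ℝ) :
    c ⬝ᵥ (Matrix.of fun i j => cosTransform μ κ (s i - s j)) *ᵥ c =
      ∫ f, κ f * expSumSq s c f ∂μ := by
  have hint (i j : ι) : Integrable
      (fun f => c i * c j * (κ f * Real.cos (inner ℝ f (s i - s j)))) μ :=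
    (integrable_mul_cos_inner hκ (s i - s j)).const_mul (c i * c j)
  calc c ⬝ᵥ (Matrix.of fun i j => cosTransform μ κ (s i - s j)) *ᵥ c
      = ∑ i, ∑ j, c i * c j * cosTransform μ κ (s i - s j) := by
        simp only [dotProduct, Matrix.mulVec, Matrix.of_apply, Finset.mul_sum]
        exact Finset.sum_congr rfl fun i _ => Finset.sum_congr rfl fun j _ => by ring
    _ = ∫ f, ∑ i, ∑ j, c i * c j * (κ f * Real.cos (inner ℝ f (s i - s j))) ∂μ := by
        rw [integral_finsetSum _ fun i _ => integrable_finsetSum _ fun j _ => hint i j]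
        simp only [integral_finsetSum _ fun j _ => hint _ j, integral_const_mul, cosTransform]
    _ = ∫ f, κ f * expSumSq s c f ∂μ := by
        simp only [expSumSq_eq, Finset.mul_sum, mul_left_comm (κ _)]

theorem mul_dotProduct_cosTransform_mulVec_le {ι : Type*} [Fintype ι] {κ' : E → ℝ} {m : ℝ}
    (hκ : Integrable κ μ) (hκ' : Integrable κ' μ) (hle : ∀ f, m * κ f ≤ κ' f) (s : ι → E)
    (c : ι → ℝ) :
    m * (c ⬝ᵥ (Matrix.of fun i j => cosTransform μ κ (s i - s j)) *ᵥ c) ≤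
      c ⬝ᵥ (Matrix.of fun i j => cosTransform μ κ' (s i - s j)) *ᵥ c := by
  rw [dotProduct_cosTransform_mulVec hκ, dotProduct_cosTransform_mulVec hκ',
    ← integral_const_mul]
  simp only [← mul_assoc]
  exact integral_mono (integrable_mul_expSumSq (hκ.const_mul m) s c)
    (integrable_mul_expSumSq hκ' s c) fun f =>
      mul_le_mul_of_nonneg_right (hle f) (expSumSq_nonneg s c f)

theorem cosTransform_comp_inv_smul [FiniteDimensional ℝ E] [μ.IsAddHaarMeasure] (φ : E → ℝ)
    {M : ℝ} (hM : 0 < M) (t : E) :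
    cosTransform μ (fun f => φ (M⁻¹ • f)) t =
      M ^ Module.finrank ℝ E * cosTransform μ φ (M • t) := by
  have h := Measure.integral_comp_inv_smul_of_nonneg μ
    (fun f => φ f * Real.cos (inner ℝ f (M • t))) hM.le
  simp only [inner_smul_left, inner_smul_right, RCLike.conj_to_real,
    mul_inv_cancel_left₀ hM.ne', smul_eq_mul] at h
  simp only [cosTransform, inner_smul_right]
  exact h

variable [FiniteDimensional ℝ E] {φ : E → ℝ}

open scoped FourierTransform in
theorem abs_cosTransform_le_norm_fourier (hφ : Integrable φ) (t : E) :
    |cosTransform volume φ t| ≤ ‖𝓕 (fun f => (φ f : ℂ)) ((2 * Real.pi)⁻¹ • t)‖ := by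
  have hphase (f : E) : -2 * Real.pi * inner ℝ f ((2 * Real.pi)⁻¹ • t) = -inner ℝ f t := by
    rw [inner_smul_right]
    field_simp
  have hint : Integrable fun f =>
      Complex.exp (((-inner ℝ f t : ℝ) : ℂ) * Complex.I) * (φ f : ℂ) :=
    hφ.ofReal.bdd_mul (c := 1) (Continuous.cexp (by fun_prop)).aestronglyMeasurable
      (ae_of_all _ fun f => (Complex.norm_exp_ofReal_mul_I _).le)
  simp only [Real.fourier_eq', hphase, smul_eq_mul]
  refine le_trans (le_of_eq ?_) (Complex.abs_re_le_norm _)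
  rw [← RCLike.re_eq_complex_re, ← integral_re hint]
  simp only [RCLike.re_eq_complex_re, Complex.re_mul_ofReal, Complex.exp_ofReal_mul_I_re,
    Real.cos_neg, cosTransform, mul_comm (φ _)]

theorem exists_norm_pow_mul_abs_cosTransform_le (hφ : ContDiff ℝ (⊤ : ℕ∞) φ)
    (hsupp : HasCompactSupport φ) (r : ℕ) :
    ∃ C : ℝ, 0 < C ∧ ∀ t, ‖t‖ ^ r * |cosTransform volume φ t| ≤ C := by
  let S : SchwartzMap E ℂ :=
    (hsupp.comp_left (g := fun x : ℝ => (x : ℂ)) Complex.ofReal_zero).toSchwartzMap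
      (Complex.ofRealCLM.contDiff.comp hφ)
  obtain ⟨C, hC, hdecay⟩ := (FourierTransform.fourier S).decay r 0
  refine ⟨(2 * Real.pi) ^ r * C, by positivity, fun t => ?_⟩
  have hdecay_t := hdecay ((2 * Real.pi)⁻¹ • t)
  rw [norm_iteratedFDeriv_zero, SchwartzMap.fourier_coe, norm_smul, mul_pow, norm_inv,
    Real.norm_of_nonneg (by positivity : 0 ≤ 2 * Real.pi), inv_pow, mul_assoc,
    inv_mul_le_iff₀ (by positivity)] at hdecay_t
  refine le_trans ?_ hdecay_t
  gcongr
  exact abs_cosTransform_le_norm_fourier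
    (hφ.continuous.integrable_of_hasCompactSupport hsupp) t

end CosineTransform

section QuadraticFormLowerBound

theorem le_dotProduct_mulVec_of_offDiag {ι : Type*} [Fintype ι] [DecidableEq ι]
    {H : Matrix ι ι ℝ} (hH : H.IsSymm) {h₀ η : ℝ} (hη : 0 ≤ η) (hdiag : ∀ i, H i i = h₀)
    (hoff : ∀ i, ∑ j ∈ Finset.univ.erase i, |H i j| ≤ η) (c : ι → ℝ) :
    (h₀ - η) * (c ⬝ᵥ c) ≤ c ⬝ᵥ H *ᵥ c := by
  have hrow (i : ι) : ∑ j, |(H - h₀ • (1 : Matrix ι ι ℝ)) i j| ≤ η := by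
    rw [← Finset.add_sum_erase _ _ (Finset.mem_univ i)]
    refine le_trans (le_of_eq ?_) (hoff i)
    simp only [Matrix.sub_apply, Matrix.smul_apply, Matrix.one_apply_eq, hdiag, smul_eq_mul,
      mul_one, sub_self, abs_zero, zero_add]
    refine Finset.sum_congr rfl fun j hj => ?_
    rw [Matrix.one_apply_ne (Finset.ne_of_mem_erase hj).symm, mul_zero, sub_zero]
  have hcol (j : ι) : ∑ i, |(H - h₀ • (1 : Matrix ι ι ℝ)) i j| ≤ η := by
    have hsymm : (H - h₀ • (1 : Matrix ι ι ℝ)).IsSymm :=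
      hH.sub (Matrix.isSymm_one.smul h₀)
    simpa only [hsymm.apply] using hrow j
  have hquad := (abs_dotProduct_mulVec_le (H - h₀ • 1) c).trans
    (mul_le_mul_of_nonneg_right (l2_opNorm_le_of_row_sum_of_col_sum hη hrow hcol)
      (Finset.sum_nonneg fun i _ => mul_self_nonneg _))
  rw [Matrix.sub_mulVec, dotProduct_sub, Matrix.smul_mulVec, Matrix.one_mulVec, dotProduct_smul,
    smul_eq_mul] at hquad
  linarith [neg_le_of_abs_le hquad]

variable {E : Type*} [NormedAddCommGroup E]

theorem one_add_pow_le_mul_pow {δ x : ℝ} (hδ : 0 < δ) (hx : δ ≤ x) (r : ℕ) :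
    1 + x ^ r ≤ (1 + (δ ^ r)⁻¹) * x ^ r := by
  have : 1 ≤ (δ ^ r)⁻¹ * x ^ r := by
    rw [← div_eq_inv_mul, one_le_div (by positivity)]
    exact pow_le_pow_left₀ hδ.le hx _
  linarith

theorem abs_apply_smul_le_of_decay [NormedSpace ℝ E] {h : E → ℝ} {C : ℝ} {r : ℕ} (hr : r ≠ 0)
    (hC : ∀ t, ‖t‖ ^ r * |h t| ≤ C) {δ M : ℝ} (hδ : 0 < δ) (hM : 1 ≤ M) {t : E} (ht : δ ≤ ‖t‖) :
    |h (M • t)| ≤ C * (1 + (δ ^ r)⁻¹) / M * (1 / (1 + ‖t‖ ^ r)) := by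
  have hM₀ : 0 < M := one_pos.trans_le hM
  have hdecay := hC (M • t)
  rw [norm_smul, Real.norm_of_nonneg hM₀.le, mul_pow] at hdecay
  rw [div_mul_div_comm, mul_one, le_div_iff₀ (by positivity)]
  calc |h (M • t)| * (M * (1 + ‖t‖ ^ r))
      ≤ |h (M • t)| * (M ^ r * ((1 + (δ ^ r)⁻¹) * ‖t‖ ^ r)) := by
        gcongr
        · exact le_self_pow₀ hM hr
        · exact one_add_pow_le_mul_pow hδ ht r
    _ = (1 + (δ ^ r)⁻¹) * (M ^ r * ‖t‖ ^ r * |h (M • t)|) := by ring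
    _ ≤ (1 + (δ ^ r)⁻¹) * C := by gcongr
    _ = C * (1 + (δ ^ r)⁻¹) := mul_comm _ _

theorem exists_scale_sum_offDiag_le [NormedSpace ℝ E] [FiniteDimensional ℝ E] {h : E → ℝ}
    {C : ℝ} {r : ℕ} (hr : Module.finrank ℝ E < r) (hC : ∀ t, ‖t‖ ^ r * |h t| ≤ C)
    {δ η : ℝ} (hδ : 0 < δ) (hη : 0 < η) :
    ∃ M : ℝ, 0 < M ∧ ∀ {ι : Type*} [Fintype ι] [DecidableEq ι] {s : ι → E},
      IsSeparatedFamily δ s → ∀ i, ∑ j ∈ Finset.univ.erase i, |h (M • (s i - s j))| ≤ η := by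
  obtain ⟨Λ, -, hsum⟩ := exists_sum_separated_le E hδ hr
  have hC₀ : 0 ≤ C := le_trans (by positivity) (hC 0)
  set C' := C * (1 + (δ ^ r)⁻¹) * Λ
  set M := max 1 (C' / η)
  have hM : 0 < M := one_pos.trans_le (le_max_left _ _)
  refine ⟨M, hM, fun {ι} _ _ s hs i => ?_⟩
  calc ∑ j ∈ Finset.univ.erase i, |h (M • (s i - s j))|
      ≤ ∑ j ∈ Finset.univ.erase i, C * (1 + (δ ^ r)⁻¹) / M * (1 / (1 + ‖s i - s j‖ ^ r)) :=
        Finset.sum_le_sum fun j hj => abs_apply_smul_le_of_decay (Nat.ne_zero_of_lt hr) hC hδ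
          (le_max_left _ _) (hs i j (Finset.ne_of_mem_erase hj).symm)
    _ ≤ ∑ j, C * (1 + (δ ^ r)⁻¹) / M * (1 / (1 + ‖s i - s j‖ ^ r)) :=
        Finset.sum_le_sum_of_subset_of_nonneg (Finset.erase_subset _ _)
          fun j _ _ => by positivity
    _ ≤ C * (1 + (δ ^ r)⁻¹) / M * Λ := by
        rw [← Finset.mul_sum]
        gcongr
        exact hsum hs (s i)
    _ = C' / M := div_mul_eq_mul_div _ _ _
    _ ≤ η := (div_le_comm₀ hM hη).2 (le_max_right _ _)

theorem mul_bump_inv_smul_le [NormedSpace ℝ E] [HasContDiffBump E] (φ : ContDiffBump (0 : E))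
    (hφ : φ.rOut ≤ 1) {κ : E → ℝ} {m M : ℝ} (hm : 0 ≤ m) (hM : 0 < M)
    (hκ_nonneg : ∀ f, 0 ≤ κ f) (hκm : ∀ f, ‖f‖ ≤ M → m ≤ κ f) (f : E) :
    m * φ (M⁻¹ • f) ≤ κ f := by
  by_cases hf : ‖f‖ ≤ M
  · exact (mul_le_of_le_one_right hm φ.le_one).trans (hκm f hf)
  · rw [φ.zero_of_le_dist, mul_zero]
    · exact hκ_nonneg f
    · rw [dist_zero_right, norm_smul, norm_inv, Real.norm_of_nonneg hM.le, ← div_eq_inv_mul]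
      exact hφ.trans ((one_le_div hM).2 (not_le.1 hf).le)

/-- A bump function scaled up by `M` has a cosine transform so concentrated that its matrix at the
separated points is nearly diagonal, and `m` times that bump lies below `κ`. -/
theorem exists_le_dotProduct_cosTransform_mulVec (E : Type*) [NormedAddCommGroup E]
    [InnerProductSpace ℝ E] [FiniteDimensional ℝ E] [MeasurableSpace E] [BorelSpace E]
    {δ : ℝ} (hδ : 0 < δ) :
    ∃ M A : ℝ, 0 < A ∧ ∀ {κ : E → ℝ} {m : ℝ}, Integrable κ → 0 ≤ m → (∀ f, 0 ≤ κ f) →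
      (∀ f, ‖f‖ ≤ M → m ≤ κ f) → ∀ {ι : Type*} [Fintype ι] {s : ι → E},
        IsSeparatedFamily δ s → ∀ c : ι → ℝ, m * A * (c ⬝ᵥ c) ≤
          c ⬝ᵥ (Matrix.of fun i j => cosTransform volume κ (s i - s j)) *ᵥ c := by
  classical
  let φ : ContDiffBump (0 : E) := ⟨1 / 2, 1, by norm_num, by norm_num⟩
  have hφ : Integrable φ := φ.continuous.integrable_of_hasCompactSupport φ.hasCompactSupport
  set h := cosTransform volume φ
  have h_zero : 0 < h 0 := by
    rw [show h 0 = _ from cosTransform_zero _ _]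
    exact φ.integral_pos
  obtain ⟨C, -, hC⟩ := exists_norm_pow_mul_abs_cosTransform_le φ.contDiff φ.hasCompactSupport
    (Module.finrank ℝ E + 1)
  obtain ⟨M, hM, hoff⟩ := exists_scale_sum_offDiag_le (Nat.lt_succ_self _) hC hδ (half_pos h_zero)
  have hφM : Integrable fun f => φ (M⁻¹ • f) := hφ.comp_smul (inv_ne_zero hM.ne')
  refine ⟨M, M ^ Module.finrank ℝ E * (h 0 / 2), by positivity,
    fun {κ m} hκ hm hκ_nonneg hκm {ι} _ s hs c => ?_⟩
  have near_diagonal : (h 0 - h 0 / 2) * (c ⬝ᵥ c) ≤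
      c ⬝ᵥ (Matrix.of fun i j => h (M • (s i - s j))) *ᵥ c :=
    le_dotProduct_mulVec_of_offDiag (Matrix.IsSymm.ext fun i j => by
        rw [← neg_sub, smul_neg]
        exact cosTransform_neg _ _ _)
      (half_pos h_zero).le (fun i => by rw [sub_self, smul_zero]) (hoff hs) c
  have scaling : (Matrix.of fun i j => cosTransform volume (fun f => φ (M⁻¹ • f)) (s i - s j)) =
      M ^ Module.finrank ℝ E • Matrix.of fun i j => h (M • (s i - s j)) := by
    ext i j
    exact cosTransform_comp_inv_smul φ hM _
  calc m * (M ^ Module.finrank ℝ E * (h 0 / 2)) * (c ⬝ᵥ c)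
      = m * (M ^ Module.finrank ℝ E * ((h 0 - h 0 / 2) * (c ⬝ᵥ c))) := by ring
    _ ≤ m * (M ^ Module.finrank ℝ E *
          (c ⬝ᵥ (Matrix.of fun i j => h (M • (s i - s j))) *ᵥ c)) := by gcongr
    _ = m * (c ⬝ᵥ (Matrix.of fun i j =>
          cosTransform volume (fun f => φ (M⁻¹ • f)) (s i - s j)) *ᵥ c) := by
        rw [scaling, Matrix.smul_mulVec, dotProduct_smul, smul_eq_mul]
    _ ≤ c ⬝ᵥ (Matrix.of fun i j => cosTransform volume κ (s i - s j)) *ᵥ c :=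
        mul_dotProduct_cosTransform_mulVec_le hφM hκ
          (mul_bump_inv_smul_le φ le_rfl hm hM hκ_nonneg hκm) s c

end QuadraticFormLowerBound

section Model

variable {d p : ℕ} {a b : ℝ} {K : (Fin p → ℝ) → EuclideanSpace ℝ (Fin d) → ℝ}

theorem paramCube_eq_pi (p : ℕ) (a b : ℝ) :
    paramCube p a b = Set.pi Set.univ fun _ => Set.Icc a b := by
  ext θ
  simp only [paramCube, Set.mem_ofPred_eq, Set.mem_univ_pi]

theorem isCompact_paramCube (p : ℕ) (a b : ℝ) : IsCompact (paramCube p a b) := by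
  rw [paramCube_eq_pi]
  exact isCompact_univ_pi fun _ => isCompact_Icc

theorem convex_paramCube (p : ℕ) (a b : ℝ) : Convex ℝ (paramCube p a b) := by
  rw [paramCube_eq_pi]
  exact convex_pi fun _ _ => convex_Icc a b

theorem uniqueDiffOn_paramCube (p : ℕ) (hab : a < b) : UniqueDiffOn ℝ (paramCube p a b) := by
  rw [paramCube_eq_pi]
  exact UniqueDiffOn.univ_pi fun _ => uniqueDiffOn_Icc hab

theorem lt_of_mem_paramCube_of_ne {θ θ' : Fin p → ℝ} (hθ : θ ∈ paramCube p a b)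
    (hθ' : θ' ∈ paramCube p a b) (hne : θ ≠ θ') : a < b := by
  obtain ⟨i, hi⟩ := Function.ne_iff.1 hne
  rcases hi.lt_or_gt with h | h
  · exact (hθ i).1.trans_lt (h.trans_le (hθ' i).2)
  · exact (hθ' i).1.trans_lt (h.trans_le (hθ i).2)

theorem opNorm_le_sum_abs_apply_single {ι : Type*} [Fintype ι] [DecidableEq ι]
    (T : (ι → ℝ) →L[ℝ] ℝ) : ‖T‖ ≤ ∑ i, |T (Pi.single i 1)| := by
  refine T.opNorm_le_bound (Finset.sum_nonneg fun i _ => abs_nonneg _) fun x => ?_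
  have hx : T x = ∑ i, x i * T (Pi.single i 1) := by
    conv_lhs => rw [pi_eq_sum_univ' x, map_sum]
    simp only [map_smul, smul_eq_mul]
  rw [hx, Finset.sum_mul]
  refine (norm_sum_le _ _).trans (Finset.sum_le_sum fun i _ => ?_)
  rw [norm_mul, mul_comm, Real.norm_eq_abs]
  gcongr
  exact norm_le_pi_norm x i

open scoped Matrix.Norms.L2Operator

theorem covMatrix_sub {n : ℕ} (k k' : EuclideanSpace ℝ (Fin d) → ℝ)
    (s : Fin n → EuclideanSpace ℝ (Fin d)) :
    covMatrix k s - covMatrix k' s = covMatrix (fun t => k t - k' t) s :=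
  rfl

theorem norm_covMatrix_le {n r : ℕ} {g : EuclideanSpace ℝ (Fin d) → ℝ}
    {s : Fin n → EuclideanSpace ℝ (Fin d)} {C Λ : ℝ} (hC : 0 ≤ C) (hΛ : 0 ≤ Λ)
    (hg : ∀ t, |g t| ≤ C * (1 / (1 + ‖t‖ ^ r)))
    (hs : ∀ x, ∑ j, 1 / (1 + ‖x - s j‖ ^ r) ≤ Λ) : ‖covMatrix g s‖ ≤ C * Λ := by
  have hsum (i : Fin n) : ∑ j, C * (1 / (1 + ‖s i - s j‖ ^ r)) ≤ C * Λ := by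
    rw [← Finset.mul_sum]
    exact mul_le_mul_of_nonneg_left (hs _) hC
  refine l2_opNorm_le_of_row_sum_of_col_sum (mul_nonneg hC hΛ)
    (fun i => (Finset.sum_le_sum fun j _ => hg _).trans (hsum i))
    (fun j => (Finset.sum_le_sum fun i _ => hg _).trans ?_)
  simpa only [norm_sub_rev] using hsum j

namespace IsRegularCovarianceModel

theorem exists_abs_le (hK : IsRegularCovarianceModel a b K) :
    ∃ C : ℝ, 0 < C ∧ ∀ θ ∈ paramCube p a b, ∀ t, |K θ t| ≤ C * (1 / (1 + ‖t‖ ^ (d + 1))) := by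
  obtain ⟨C, hC⟩ := hK.bound 0 (by norm_num) Fin.elim0
  refine ⟨max C 1, by positivity, fun θ hθ t => ?_⟩
  have h := hC θ hθ t
  rw [iteratedFDerivWithin_zero_apply] at h
  rw [mul_one_div]
  exact h.trans (by gcongr; exact le_max_left _ _)

theorem differentiableOn (hK : IsRegularCovarianceModel a b K) (t : EuclideanSpace ℝ (Fin d)) :
    DifferentiableOn ℝ (fun θ => K θ t) (paramCube p a b) := by
  have h := hK.differentiable t 0 (by norm_num)
  rw [iteratedFDerivWithin_zero_eq_comp] at h
  exact (LinearIsometryEquiv.comp_differentiableOn_iff _).1 h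

theorem exists_norm_fderivWithin_le (hK : IsRegularCovarianceModel a b K) (hab : a < b) :
    ∃ C : ℝ, 0 ≤ C ∧ ∀ θ ∈ paramCube p a b, ∀ t,
      ‖fderivWithin ℝ (fun θ' => K θ' t) (paramCube p a b) θ‖ ≤
        C * (1 / (1 + ‖t‖ ^ (d + 1))) := by
  choose C hC using fun i : Fin p => hK.bound 1 (by norm_num) fun _ => i
  refine ⟨∑ i, |C i|, Finset.sum_nonneg fun i _ => abs_nonneg _, fun θ hθ t => ?_⟩
  rw [Finset.sum_mul]
  refine (opNorm_le_sum_abs_apply_single _).trans (Finset.sum_le_sum fun i _ => ?_)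
  have h := hC i θ hθ t
  rw [iteratedFDerivWithin_one_apply (uniqueDiffOn_paramCube p hab θ hθ)] at h
  rw [mul_one_div]
  exact h.trans (by gcongr; exact le_abs_self _)

theorem exists_lipschitz (hK : IsRegularCovarianceModel a b K) :
    ∃ C : ℝ, 0 ≤ C ∧ ∀ θ ∈ paramCube p a b, ∀ θ' ∈ paramCube p a b, ∀ t,
      |K θ t - K θ' t| ≤ C * ‖θ - θ'‖ * (1 / (1 + ‖t‖ ^ (d + 1))) := by
  by_cases hab : a < b
  · obtain ⟨C, hC₀, hC⟩ := hK.exists_norm_fderivWithin_le hab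
    refine ⟨C, hC₀, fun θ hθ θ' hθ' t => ?_⟩
    rw [mul_right_comm]
    exact (convex_paramCube p a b).norm_image_sub_le_of_norm_fderivWithin_le
      (hK.differentiableOn t) (fun x hx => hC x hx t) hθ' hθ
  · refine ⟨0, le_rfl, fun θ hθ θ' hθ' t => ?_⟩
    have heq : θ = θ' := by
      by_contra hne
      exact hab (lt_of_mem_paramCube_of_ne hθ hθ' hne)
    rw [heq, sub_self, abs_zero, zero_mul, zero_mul]

theorem integrable_re_hat (hK : IsRegularCovarianceModel a b K) {θ : Fin p → ℝ}
    (hθ : θ ∈ paramCube p a b) : Integrable fun f => (fourierHat (K θ) f).re :=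
  (hK.integrable_hat θ hθ).re

theorem eq_cosTransform (hK : IsRegularCovarianceModel a b K) {θ : Fin p → ℝ}
    (hθ : θ ∈ paramCube p a b) : K θ = cosTransform volume fun f => (fourierHat (K θ) f).re := by
  funext t
  have hint : Integrable fun f =>
      fourierHat (K θ) f * Complex.exp (Complex.I * ((inner ℝ f t : ℝ) : ℂ)) := by
    refine (hK.integrable_hat θ hθ).mul_bdd (c := 1)
      (Continuous.cexp (by fun_prop)).aestronglyMeasurable (ae_of_all _ fun f => ?_)
    rw [mul_comm, Complex.norm_exp_ofReal_mul_I]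
  rw [← Complex.ofReal_re (K θ t), hK.inversion θ hθ t, ← RCLike.re_eq_complex_re,
    ← integral_re hint]
  simp only [RCLike.re_eq_complex_re, Complex.mul_re, (hK.hat_pos θ hθ _).2, zero_mul, sub_zero,
    mul_comm Complex.I, Complex.exp_ofReal_mul_I_re, cosTransform]

theorem continuous (hK : IsRegularCovarianceModel a b K) {θ : Fin p → ℝ}
    (hθ : θ ∈ paramCube p a b) : Continuous (K θ) := by
  rw [hK.eq_cosTransform hθ]
  exact continuous_cosTransform (hK.integrable_re_hat hθ)

theorem exists_le_re_hat (hK : IsRegularCovarianceModel a b K) (M : ℝ) :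
    ∃ m : ℝ, 0 < m ∧ ∀ θ ∈ paramCube p a b, ∀ f, ‖f‖ ≤ M → m ≤ (fourierHat (K θ) f).re := by
  have hcont : ContinuousOn
      (fun x : EuclideanSpace ℝ (Fin d) × (Fin p → ℝ) => (fourierHat (K x.2) x.1).re)
      (Metric.closedBall 0 M ×ˢ paramCube p a b) :=
    Complex.continuous_re.comp_continuousOn
      (hK.hat_continuous.mono (Set.prod_mono (Set.subset_univ _) subset_rfl))
  obtain ⟨m, hm, h⟩ := ((isCompact_closedBall _ _).prod
    (isCompact_paramCube p a b)).exists_forall_le' hcont (a := 0)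
      fun x hx => (hK.hat_pos x.2 hx.2 x.1).1
  exact ⟨m, hm, fun θ hθ f hf => h (f, θ) ⟨mem_closedBall_zero_iff.2 hf, hθ⟩⟩

theorem isSymm_covMatrix (hK : IsRegularCovarianceModel a b K) {θ : Fin p → ℝ}
    (hθ : θ ∈ paramCube p a b) {n : ℕ} (s : Fin n → EuclideanSpace ℝ (Fin d)) :
    (covMatrix (K θ) s).IsSymm :=
  Matrix.IsSymm.ext fun i j => by
    simp only [covMatrix, Matrix.of_apply]
    rw [← (hK.stationary θ hθ).1, neg_sub]

theorem exists_hasSpectrumIn (hK : IsRegularCovarianceModel a b K) {δ : ℝ} (hδ : 0 < δ) :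
    ∃ l u : ℝ, ∀ θ ∈ paramCube p a b, ∀ {n : ℕ} {s : Fin n → EuclideanSpace ℝ (Fin d)},
      IsSeparatedFamily δ s → HasSpectrumIn (covMatrix (K θ) s) l u := by
  obtain ⟨M, A, hA, hquad⟩ :=
    exists_le_dotProduct_cosTransform_mulVec (EuclideanSpace ℝ (Fin d)) hδ
  obtain ⟨m, hm, hmK⟩ := hK.exists_le_re_hat M
  obtain ⟨Λ, hΛ, hsum⟩ := exists_sum_separated_le (EuclideanSpace ℝ (Fin d)) hδ
    (finrank_euclideanSpace_fin.trans_lt d.lt_succ_self)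
  obtain ⟨C, hC, hKC⟩ := hK.exists_abs_le
  refine ⟨m * A, max (m * A) (C * Λ), fun θ hθ {n s} hs =>
    ⟨by positivity, le_max_left _ _, hK.isSymm_covMatrix hθ s, fun x => ?_,
      (norm_covMatrix_le hC.le hΛ.le (hKC θ hθ) (hsum hs)).trans (le_max_right _ _)⟩⟩
  have h := hquad (hK.integrable_re_hat hθ) hm.le (fun f => (hK.hat_pos θ hθ f).1.le)
    (hmK θ hθ) hs x
  rwa [← hK.eq_cosTransform hθ] at h

theorem exists_norm_covMatrix_sub_le (hK : IsRegularCovarianceModel a b K) {δ : ℝ} (hδ : 0 < δ) :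
    ∃ C : ℝ, 0 ≤ C ∧ ∀ θ ∈ paramCube p a b, ∀ θ' ∈ paramCube p a b, ∀ {n : ℕ}
      {s : Fin n → EuclideanSpace ℝ (Fin d)}, IsSeparatedFamily δ s →
        ‖covMatrix (K θ) s - covMatrix (K θ') s‖ ≤ C * ‖θ - θ'‖ := by
  obtain ⟨Λ, hΛ, hsum⟩ := exists_sum_separated_le (EuclideanSpace ℝ (Fin d)) hδ
    (finrank_euclideanSpace_fin.trans_lt d.lt_succ_self)
  obtain ⟨C, hC, hKC⟩ := hK.exists_lipschitz
  refine ⟨C * Λ, by positivity, fun θ hθ θ' hθ' {n s} hs => ?_⟩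
  rw [covMatrix_sub, mul_right_comm]
  exact norm_covMatrix_le (by positivity) hΛ.le (hKC θ hθ θ' hθ') (hsum hs)

end IsRegularCovarianceModel

end Model

section Whitening

open scoped Matrix.Norms.L2Operator

variable {m : Type*} [Fintype m] [DecidableEq m]

theorem exists_orthogonal_diagonalization {N : Matrix m m ℝ} (hN : N.IsSymm) :
    ∃ (W : Matrix m m ℝ) (v : m → ℝ), Wᵀ * W = 1 ∧ N = W * Matrix.diagonal v * Wᵀ ∧
      ∀ i, |v i| ≤ ‖N‖ := by
  have hN' : N.IsHermitian := by
    rwa [Matrix.IsHermitian, Matrix.conjTranspose_eq_transpose_of_trivial]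
  set U := hN'.eigenvectorUnitary
  have star_eq : star (U : Matrix m m ℝ) = (U : Matrix m m ℝ)ᵀ := by
    rw [Matrix.star_eq_conjTranspose, Matrix.conjTranspose_eq_transpose_of_trivial]
  have spectral : N = U * Matrix.diagonal hN'.eigenvalues * star (U : Matrix m m ℝ) :=
    hN'.spectral_theorem
  refine ⟨U, hN'.eigenvalues, ?_, ?_, fun i => ?_⟩
  · rw [← star_eq, Unitary.coe_star_mul_self]
  · rwa [← star_eq]
  · calc |hN'.eigenvalues i| ≤ ‖Matrix.diagonal hN'.eigenvalues‖ := by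
          simpa only [Matrix.diagonal_apply_eq] using
            abs_apply_le_l2_opNorm (Matrix.diagonal hN'.eigenvalues) i i
      _ = ‖U * Matrix.diagonal hN'.eigenvalues * star (U : Matrix m m ℝ)‖ := by
          rw [← Unitary.coe_star, CStarRing.norm_mul_coe_unitary, CStarRing.norm_coe_unitary_mul]
      _ = ‖N‖ := congrArg norm spectral.symm

namespace HasSpectrumIn

variable {R : Matrix m m ℝ} {l u : ℝ}

open scoped MatrixOrder in
theorem exists_isUnit_det_eq_transpose_mul_self (hR : HasSpectrumIn R l u) :
    ∃ S : Matrix m m ℝ, IsUnit S.det ∧ R = Sᵀ * S ∧ ‖S‖ * ‖S‖ ≤ u := by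
  obtain ⟨S, hS⟩ := CStarAlgebra.nonneg_iff_eq_star_mul_self.1 hR.posDef.posSemidef.nonneg
  rw [Matrix.star_eq_conjTranspose] at hS
  refine ⟨S, ?_, by rwa [← Matrix.conjTranspose_eq_transpose_of_trivial], ?_⟩
  · have hdet := hR.isUnit_det
    rw [hS, Matrix.det_mul] at hdet
    exact isUnit_of_mul_isUnit_right hdet
  · rw [← Matrix.l2_opNorm_conjTranspose_mul_self, ← hS]
    exact hR.upper

theorem exists_whitening (hR : HasSpectrumIn R l u) {B : Matrix m m ℝ} (hB : B.IsSymm) :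
    ∃ (T : Matrix m m ℝ) (v : m → ℝ), T * R * Tᵀ = 1 ∧ B = Tᵀ * Matrix.diagonal v * T ∧
      ∀ i, |v i| ≤ u * ‖B‖ := by
  obtain ⟨S, hS, rfl, hSu⟩ := hR.exists_isUnit_det_eq_transpose_mul_self
  have hSt : IsUnit Sᵀ.det := by rwa [Matrix.det_transpose]
  have hN : (S * B * Sᵀ).IsSymm := by
    rw [Matrix.IsSymm, Matrix.transpose_mul, Matrix.transpose_mul, Matrix.transpose_transpose,
      hB.eq, mul_assoc]
  obtain ⟨W, v, hW, hWN, hv⟩ := exists_orthogonal_diagonalization hN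
  refine ⟨Wᵀ * Sᵀ⁻¹, v, ?_, ?_, fun i => (hv i).trans ?_⟩
  · calc Wᵀ * Sᵀ⁻¹ * (Sᵀ * S) * (Wᵀ * Sᵀ⁻¹)ᵀ = Wᵀ * (Sᵀ⁻¹ * Sᵀ) * (S * S⁻¹) * W := by
          simp only [Matrix.transpose_mul, Matrix.transpose_transpose, Matrix.transpose_nonsing_inv,
            mul_assoc]
      _ = 1 := by
          rw [Matrix.nonsing_inv_mul _ hSt, Matrix.mul_nonsing_inv _ hS, mul_one, mul_one, hW]
  · calc B = S⁻¹ * S * B * (Sᵀ * Sᵀ⁻¹) := by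
          rw [Matrix.nonsing_inv_mul _ hS, Matrix.mul_nonsing_inv _ hSt, one_mul, mul_one]
      _ = S⁻¹ * (S * B * Sᵀ) * Sᵀ⁻¹ := by simp only [mul_assoc]
      _ = (Wᵀ * Sᵀ⁻¹)ᵀ * Matrix.diagonal v * (Wᵀ * Sᵀ⁻¹) := by
          rw [hWN]
          simp only [Matrix.transpose_mul, Matrix.transpose_transpose,
            Matrix.transpose_nonsing_inv, mul_assoc]
  · calc ‖S * B * Sᵀ‖ ≤ ‖S‖ * ‖B‖ * ‖Sᵀ‖ :=
          (norm_mul_le _ _).trans (by gcongr; exact norm_mul_le _ _)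
      _ = ‖S‖ * ‖S‖ * ‖B‖ := by
          rw [l2_opNorm_transpose]
          ring
      _ ≤ u * ‖B‖ := by gcongr

end HasSpectrumIn

end Whitening

section GaussianVectors

open scoped Matrix.Norms.L2Operator

/-- `y` is a centered Gaussian vector with covariance matrix `R`. -/
structure IsCenteredGaussianVector {ι Ω : Type*} [MeasurableSpace Ω] [Fintype ι]
    (y : ι → Ω → ℝ) (R : Matrix ι ι ℝ) (P : Measure Ω) : Prop where
  gaussian : HasGaussianLaw (fun ω i => y i ω) P
  centered : ∀ i, ∫ ω, y i ω ∂P = 0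
  covariance : ∀ i j, cov[y i, y j; P] = R i j

/-- The variance of the square of a standard Gaussian variable. -/
noncomputable def gaussianSqVariance : ℝ := Var[fun x : ℝ => x ^ 2; gaussianReal 0 1]

theorem gaussianSqVariance_nonneg : 0 ≤ gaussianSqVariance :=
  variance_nonneg _ _

variable {ι Ω : Type*} [Fintype ι] [MeasurableSpace Ω] {P : Measure Ω}

theorem memLp_sq_of_hasGaussianLaw {Z : Ω → ℝ} (hZ : HasGaussianLaw Z P) :
    MemLp (fun ω => Z ω ^ 2) 2 P := by
  rw [memLp_two_iff_integrable_sq (hZ.aemeasurable.pow_const 2).aestronglyMeasurable]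
  have h : MemLp Z (4 : ℕ) P := hZ.memLp (by norm_num)
  refine (h.integrable_norm_pow (by norm_num)).congr (ae_of_all _ fun ω => ?_)
  simp only [Real.norm_eq_abs]
  rw [← pow_mul, ← abs_pow, abs_of_nonneg (by positivity)]

namespace IsCenteredGaussianVector

variable {y : ι → Ω → ℝ} {R : Matrix ι ι ℝ}

theorem memLp_two (hy : IsCenteredGaussianVector y R P) (i : ι) : MemLp (y i) 2 P :=
  (hy.gaussian.eval i).memLp_two

theorem mulVec {κ : Type*} [Fintype κ] [IsFiniteMeasure P] (hy : IsCenteredGaussianVector y R P)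
    (T : Matrix κ ι ℝ) :
    IsCenteredGaussianVector (fun i ω => (T *ᵥ fun j => y j ω) i) (T * R * Tᵀ) P where
  gaussian := hy.gaussian.map_fun (Matrix.mulVecLin T).toContinuousLinearMap
  centered i := by
    simp only [Matrix.mulVec, dotProduct]
    rw [integral_finsetSum _ fun j _ => (hy.gaussian.eval j).integrable.const_mul _]
    simp only [integral_const_mul, hy.centered, mul_zero, Finset.sum_const_zero]
  covariance i j := by
    simp only [Matrix.mulVec, dotProduct]
    rw [covariance_fun_sum_fun_sum (fun k => (hy.memLp_two k).const_mul _)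
      fun k => (hy.memLp_two k).const_mul _]
    simp only [covariance_const_mul_left, covariance_const_mul_right, hy.covariance,
      Matrix.mul_apply, Matrix.transpose_apply, Finset.sum_mul]
    rw [Finset.sum_comm]
    exact Finset.sum_congr rfl fun _ _ => Finset.sum_congr rfl fun _ _ => by ring

theorem integral_mul [IsProbabilityMeasure P] (hy : IsCenteredGaussianVector y R P) (i j : ι) :
    ∫ ω, y i ω * y j ω ∂P = R i j := by
  rw [← hy.covariance, covariance_eq_sub (hy.memLp_two i) (hy.memLp_two j), hy.centered,
    zero_mul, sub_zero]
  rfl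

theorem integral_quadraticForm [IsProbabilityMeasure P] (hy : IsCenteredGaussianVector y R P)
    (B : Matrix ι ι ℝ) :
    ∫ ω, (fun i => y i ω) ⬝ᵥ B *ᵥ (fun i => y i ω) ∂P = (B * R).trace := by
  have hint (i j : ι) : Integrable (fun ω => B i j * (y j ω * y i ω)) P :=
    ((hy.memLp_two j).integrable_mul (hy.memLp_two i)).const_mul _
  have expand (ω : Ω) : (fun i => y i ω) ⬝ᵥ B *ᵥ (fun i => y i ω) =
      ∑ i, ∑ j, B i j * (y j ω * y i ω) := by
    simp only [dotProduct, Matrix.mulVec, Finset.mul_sum]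
    exact Finset.sum_congr rfl fun i _ => Finset.sum_congr rfl fun j _ => by ring
  simp only [expand]
  rw [integral_finsetSum _ fun i _ => integrable_finsetSum _ fun j _ => hint i j]
  simp only [integral_finsetSum _ fun j _ => hint _ j, integral_const_mul, hy.integral_mul,
    Matrix.trace, Matrix.diag_apply, Matrix.mul_apply]

section Standard

variable [DecidableEq ι] {z : ι → Ω → ℝ}

theorem iIndepFun_of_one (hz : IsCenteredGaussianVector z 1 P) : iIndepFun z P :=
  hz.gaussian.iIndepFun_of_covariance_eq_zero fun i j hij => by
    rw [hz.covariance, Matrix.one_apply_ne hij]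

theorem map_eq_of_one (hz : IsCenteredGaussianVector z 1 P) (i : ι) :
    P.map (z i) = gaussianReal 0 1 := by
  have hvar : Var[z i; P] = 1 := by
    rw [← covariance_self (hz.gaussian.eval i).aemeasurable, hz.covariance, Matrix.one_apply_eq]
  rw [(hz.gaussian.eval i).map_eq_gaussianReal, hz.centered, hvar, Real.toNNReal_one]

theorem variance_sum_mul_sq (hz : IsCenteredGaussianVector z 1 P) (v : ι → ℝ) :
    Var[fun ω => ∑ i, v i * z i ω ^ 2; P] = ∑ i, v i ^ 2 * gaussianSqVariance := by
  have hmem (i : ι) : MemLp (fun ω => v i * z i ω ^ 2) 2 P :=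
    (memLp_sq_of_hasGaussianLaw (hz.gaussian.eval i)).const_mul _
  have hindep : iIndepFun (fun i ω => v i * z i ω ^ 2) P :=
    hz.iIndepFun_of_one.comp (fun i x => v i * x ^ 2) fun i => by fun_prop
  have hsum := IndepFun.variance_sum (s := Finset.univ) (fun i _ => hmem i)
    fun i _ j _ hij => hindep.indepFun hij
  rw [Finset.sum_fn] at hsum
  rw [hsum]
  refine Finset.sum_congr rfl fun i _ => ?_
  rw [variance_const_mul, gaussianSqVariance, ← hz.map_eq_of_one i,
    variance_map (by fun_prop) (hz.gaussian.eval i).aemeasurable]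
  rfl

end Standard

variable [DecidableEq ι] {B : Matrix ι ι ℝ} {l u β : ℝ}

theorem memLp_two_quadraticForm_and_variance_le [IsFiniteMeasure P]
    (hy : IsCenteredGaussianVector y R P) (hR : HasSpectrumIn R l u) (hB : B.IsSymm)
    (hβ : ‖B‖ ≤ β) :
    MemLp (fun ω => (fun i => y i ω) ⬝ᵥ B *ᵥ (fun i => y i ω)) 2 P ∧
      Var[fun ω => (fun i => y i ω) ⬝ᵥ B *ᵥ (fun i => y i ω); P] ≤
        Fintype.card ι * ((u * β) ^ 2 * gaussianSqVariance) := by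
  obtain ⟨T, v, hT, hBT, hv⟩ := hR.exists_whitening hB
  have hz := hT ▸ hy.mulVec T
  have diagonalized (ω : Ω) : (fun i => y i ω) ⬝ᵥ B *ᵥ (fun i => y i ω) =
      ∑ i, v i * (T *ᵥ fun j => y j ω) i ^ 2 := by
    rw [hBT, ← Matrix.mulVec_mulVec, ← Matrix.mulVec_mulVec, Matrix.dotProduct_mulVec,
      Matrix.vecMul_transpose]
    simp only [dotProduct, Matrix.mulVec_diagonal]
    exact Finset.sum_congr rfl fun i _ => by ring
  simp only [diagonalized]
  refine ⟨memLp_finsetSum _ fun i _ =>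
    (memLp_sq_of_hasGaussianLaw (hz.gaussian.eval i)).const_mul _, ?_⟩
  rw [hz.variance_sum_mul_sq, ← nsmul_eq_mul, ← Finset.card_univ]
  refine Finset.sum_le_card_nsmul _ _ _ fun i _ =>
    mul_le_mul_of_nonneg_right ?_ gaussianSqVariance_nonneg
  have : 0 ≤ u := hR.upper_pos.le
  rw [← sq_abs]
  exact pow_le_pow_left₀ (abs_nonneg _) ((hv i).trans (by gcongr)) 2

theorem measure_le_abs_quadraticForm_sub_trace_le [IsProbabilityMeasure P]
    (hy : IsCenteredGaussianVector y R P) (hR : HasSpectrumIn R l u) (hB : B.IsSymm)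
    (hβ : ‖B‖ ≤ β) {t : ℝ} (ht : 0 < t) :
    P {ω | t ≤ |(fun i => y i ω) ⬝ᵥ B *ᵥ (fun i => y i ω) - (B * R).trace|} ≤
      ENNReal.ofReal (Fintype.card ι * ((u * β) ^ 2 * gaussianSqVariance) / t ^ 2) := by
  obtain ⟨hmem, hvar⟩ := hy.memLp_two_quadraticForm_and_variance_le hR hB hβ
  rw [← hy.integral_quadraticForm]
  refine (meas_ge_le_variance_div_sq hmem ht).trans (ENNReal.ofReal_le_ofReal ?_)
  gcongr

end IsCenteredGaussianVector

end GaussianVectors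

section GaussianObservations

open scoped Matrix.Norms.L2Operator

theorem hasGaussianLaw_pi_of_isGaussianProcess {T ι Ω : Type*} [Finite ι] [MeasurableSpace Ω]
    {P : Measure Ω} {Z : T → Ω → ℝ} (hZ : IsGaussianProcess Z P) (s : ι → T) :
    HasGaussianLaw (fun ω i => Z (s i) ω) P := by
  have := Fintype.ofFinite ι
  exact ((hZ.comp_right s).hasGaussianLaw Finset.univ).map_fun
    (LinearMap.funLeft ℝ ℝ fun i =>
      (⟨i, Finset.mem_univ i⟩ : (Finset.univ : Finset ι))).toContinuousLinearMap

namespace IsCenteredGaussianProcess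

variable {d n : ℕ} {Ω : Type*} [MeasurableSpace Ω] {P : Measure Ω}
  {Y : EuclideanSpace ℝ (Fin d) → Ω → ℝ} {k₀ k : EuclideanSpace ℝ (Fin d) → ℝ}

theorem isCenteredGaussianVector (hY : IsCenteredGaussianProcess Y P k₀)
    (s : Fin n → EuclideanSpace ℝ (Fin d)) :
    IsCenteredGaussianVector (fun i => Y (s i)) (covMatrix k₀ s) P where
  gaussian := hasGaussianLaw_pi_of_isGaussianProcess hY.gaussian s
  centered i := hY.centered (s i)
  covariance i j := hY.covariance (s i) (s j)

variable [IsProbabilityMeasure P] {s : Fin n → EuclideanSpace ℝ (Fin d)} {l u : ℝ}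

theorem measure_two_mul_lt_sum_sq_le (hY : IsCenteredGaussianProcess Y P k₀)
    (hR : HasSpectrumIn (covMatrix k₀ s) l u) (hk₀ : k₀ 0 = 1) (hn : 0 < n) :
    P {ω | 2 * (n : ℝ) < (fun i => Y (s i) ω) ⬝ᵥ (fun i => Y (s i) ω)} ≤
      ENNReal.ofReal (u ^ 2 * gaussianSqVariance / n) := by
  have hn' : (0 : ℝ) < n := by exact_mod_cast hn
  have norm_one_le : ‖(1 : Matrix (Fin n) (Fin n) ℝ)‖ ≤ 1 := by
    rw [← Matrix.diagonal_one]
    exact l2_opNorm_diagonal_le zero_le_one fun _ => abs_one.le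
  have trace_eq : ((1 : Matrix (Fin n) (Fin n) ℝ) * covMatrix k₀ s).trace = n := by
    simp [Matrix.trace, covMatrix, hk₀]
  have h := (hY.isCenteredGaussianVector s).measure_le_abs_quadraticForm_sub_trace_le hR
    Matrix.isSymm_one norm_one_le hn'
  simp only [trace_eq, Matrix.one_mulVec, mul_one, Fintype.card_fin] at h
  refine (measure_mono fun ω (hω : 2 * (n : ℝ) < _) => ?_).trans (h.trans_eq ?_)
  · rw [Set.mem_ofPred_eq]
    exact le_trans (by linarith) (le_abs_self _)
  · congr 1
    field_simp

theorem measure_cvCriterion_sub_lt_le (hY : IsCenteredGaussianProcess Y P k₀)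
    (hR₀ : HasSpectrumIn (covMatrix k₀ s) l u) (hR : HasSpectrumIn (covMatrix k s) l u)
    (hk₀ : k₀ 0 = 1) (hk : k 0 = 1) (hn : 0 < n) {γ : ℝ} (hγ : 0 < γ)
    (hfrob : 4 * (1 + u ^ 2) * (u ^ 2 / l) ^ 2 / l * γ * n ≤
      frobSq (covMatrix k s - covMatrix k₀ s)) :
    P {ω | cvCriterion k s (fun i => Y (s i) ω) - cvCriterion k₀ s (fun i => Y (s i) ω) < γ * n} ≤
      ENNReal.ofReal ((u * (2 * (u ^ 2 / l ^ 2) * (2 * (u ^ 2 / l ^ 2)))) ^ 2 *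
        gaussianSqVariance / γ ^ 2 / n) := by
  set A := looMatrix (covMatrix k s)
  set A₀ := looMatrix (covMatrix k₀ s)
  have hl := hR.lower_pos
  have hu := hR.upper_pos
  have hn' : (0 : ℝ) < n := by exact_mod_cast hn
  have isSymm : (Aᵀ * A - A₀ᵀ * A₀).IsSymm :=
    (Matrix.isSymm_transpose_mul_self A).sub (Matrix.isSymm_transpose_mul_self A₀)
  have norm_le : ‖Aᵀ * A - A₀ᵀ * A₀‖ ≤ 2 * (u ^ 2 / l ^ 2) * (2 * (u ^ 2 / l ^ 2)) := by
    refine (norm_transpose_mul_self_sub_le hR.norm_looMatrix_le hR₀.norm_looMatrix_le).trans ?_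
    gcongr
    rw [two_mul]
    exact (norm_sub_le _ _).trans (add_le_add hR.norm_looMatrix_le hR₀.norm_looMatrix_le)
  have mean_ge : 2 * (γ * n) ≤ ((Aᵀ * A - A₀ᵀ * A₀) * covMatrix k₀ s).trace := by
    refine le_trans ?_ (hR.frobSq_looMatrix_sub_le hR₀)
    refine le_of_mul_le_mul_left ?_ (show 0 < 2 * (1 + u ^ 2) * (u ^ 2 / l) ^ 2 / l by positivity)
    calc 2 * (1 + u ^ 2) * (u ^ 2 / l) ^ 2 / l * (2 * (γ * n))
        = 4 * (1 + u ^ 2) * (u ^ 2 / l) ^ 2 / l * γ * n := by ring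
      _ ≤ 2 * (1 + u ^ 2) * (u ^ 2 / l) ^ 2 * frobSq (A - A₀) :=
          hfrob.trans (hR.frobSq_sub_le hR₀ (fun i => by simp [covMatrix, hk])
            fun i => by simp [covMatrix, hk₀])
      _ = 2 * (1 + u ^ 2) * (u ^ 2 / l) ^ 2 / l * (l * frobSq (A - A₀)) := by field_simp
  have h := (hY.isCenteredGaussianVector s).measure_le_abs_quadraticForm_sub_trace_le hR₀ isSymm
    norm_le (mul_pos hγ hn')
  rw [Fintype.card_fin] at h
  refine (measure_mono fun ω hω => ?_).trans (h.trans_eq ?_)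
  · rw [Set.mem_ofPred_eq, hR.cvCriterion_sub_eq hR₀] at hω
    rw [Set.mem_ofPred_eq, abs_sub_comm]
    exact le_trans (by linarith) (le_abs_self _)
  · congr 1
    field_simp

end IsCenteredGaussianProcess

end GaussianObservations

section MinimumContrast

theorem tendstoInMeasure_of_isCompact_of_separated {ι Θ Ω : Type*} {l : Filter ι}
    [PseudoMetricSpace Θ] [MeasurableSpace Ω] {P : Measure Ω} {S : Set Θ} (hS : IsCompact S)
    {θ₀ : Θ} {F : ι → Θ → Ω → ℝ} {r : ι → ℝ} (hr : ∀ᶠ n in l, 0 < r n) {D : ℝ} (hD : 0 < D)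
    (hlip : Tendsto (fun n => P {ω | ∃ θ ∈ S, ∃ θ' ∈ S,
      D * dist θ θ' * r n < |F n θ ω - F n θ' ω|}) l (𝓝 0))
    (hsep : ∀ θ ∈ S, θ ≠ θ₀ → ∃ γ : ℝ, 0 < γ ∧
      Tendsto (fun n => P {ω | F n θ ω - F n θ₀ ω < γ * r n}) l (𝓝 0))
    {θhat : ι → Ω → Θ}
    (hθhat : ∀ᶠ n in l, ∀ᵐ ω ∂P, θhat n ω ∈ S ∧ F n (θhat n ω) ω ≤ F n θ₀ ω) :
    TendstoInMeasure P θhat l fun _ => θ₀ := by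
  choose! γ hγ hγ_lim using hsep
  rw [tendstoInMeasure_iff_dist]
  intro η hη
  have ne_of_le_dist (θ : Θ) (hθ : η ≤ dist θ θ₀) : θ ≠ θ₀ := by
    rintro rfl
    exact (hη.trans_le hθ).ne' (dist_self θ)
  have isCompact_far : IsCompact (S ∩ {θ | η ≤ dist θ θ₀}) :=
    hS.inter_right (isClosed_le continuous_const (by fun_prop))
  obtain ⟨T, hTS, hT⟩ := isCompact_far.elim_nhds_subcover (fun θ => Metric.ball θ (γ θ / D))
    fun θ hθ => Metric.ball_mem_nhds θ (div_pos (hγ θ hθ.1 (ne_of_le_dist θ hθ.2)) hD)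
  have union_bound := hlip.add <| tendsto_finsetSum T fun θ hθ =>
    hγ_lim θ (hTS θ hθ).1 (ne_of_le_dist θ (hTS θ hθ).2)
  rw [Finset.sum_const_zero, add_zero] at union_bound
  refine tendsto_of_tendsto_of_tendsto_of_le_of_le' tendsto_const_nhds union_bound
    (Eventually.of_forall fun _ => zero_le) ?_
  filter_upwards [hr, hθhat] with n hrn hmin
  refine (measure_mono_ae ?_).trans ((measure_union_le _ _).trans
    (add_le_add le_rfl (measure_biUnion_finset_le T _)))
  filter_upwards [hmin] with ω ⟨hωS, hωmin⟩ hdist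
  by_contra hω
  replace hω : ω ∉ _ ∪ ⋃ θ ∈ T, _ := hω
  simp only [Set.mem_union, Set.mem_iUnion, Set.mem_ofPred_eq, not_or, not_exists, not_and,
    not_lt] at hω
  obtain ⟨hω_lip, hω_sep⟩ := hω
  obtain ⟨θ, hθT, hθ⟩ := Set.mem_iUnion₂.1 (hT ⟨hωS, hdist⟩)
  have close : D * dist (θhat n ω) θ * r n < γ θ * r n :=
    mul_lt_mul_of_pos_right ((lt_div_iff₀' hD).1 hθ) hrn
  have lower := (abs_le.1 (hω_lip _ hωS θ (hTS θ hθT).1)).1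
  linarith [hω_sep θ hθT]

end MinimumContrast

section Measurability

variable {Ω m : Type*} [MeasurableSpace Ω] [Fintype m] [DecidableEq m]

theorem measurable_matrix_det {M : Ω → Matrix m m ℝ} (hM : ∀ i j, Measurable fun ω => M ω i j) :
    Measurable fun ω => (M ω).det := by
  simp only [Matrix.det_apply]
  exact Finset.measurable_sum _ fun σ _ =>
    (Finset.measurable_prod _ fun i _ => hM (σ i) i).const_smul _

theorem measurable_matrix_inv_apply {M : Ω → Matrix m m ℝ}
    (hM : ∀ i j, Measurable fun ω => M ω i j) (i j : m) :
    Measurable fun ω => (M ω)⁻¹ i j := by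
  simp only [Matrix.inv_def, Ring.inverse_eq_inv', Matrix.smul_apply, smul_eq_mul,
    Matrix.adjugate_apply]
  refine (measurable_matrix_det hM).inv.mul (measurable_matrix_det fun k l => ?_)
  simp only [Matrix.updateRow_apply]
  split_ifs
  exacts [measurable_const, hM k l]

theorem measurable_cvCriterion {d n : ℕ} {k : EuclideanSpace ℝ (Fin d) → ℝ} (hk : Measurable k)
    {s : Ω → Fin n → EuclideanSpace ℝ (Fin d)} (hs : ∀ i, Measurable fun ω => s ω i)
    {y : Ω → Fin n → ℝ} (hy : ∀ i, Measurable fun ω => y ω i) :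
    Measurable fun ω => cvCriterion k (s ω) (y ω) := by
  have hR (i j : Fin n) : Measurable fun ω => covMatrix k (s ω) i j :=
    hk.comp ((hs i).sub (hs j))
  refine Finset.measurable_sum _ fun i _ => ((hy i).sub ?_).pow_const 2
  simp only [krigingLOO, dotProduct, Matrix.mulVec]
  exact Finset.measurable_sum _ fun j _ => (hR _ _).mul <| Finset.measurable_sum _ fun l _ =>
    (measurable_matrix_inv_apply (fun _ _ => hR _ _) j l).mul (hy l)

end Measurability

section RandomDesign

open scoped Matrix.Norms.L2Operator

theorem measure_prod_le_add_of_ae_notMem {α β : Type*} [MeasurableSpace α] [MeasurableSpace β]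
    {μ : Measure α} {ν : Measure β} [IsProbabilityMeasure μ] [IsProbabilityMeasure ν]
    {E : Set (α × β)} (hE : MeasurableSet E) {S : Set α} {r : ℝ≥0∞}
    (h : ∀ᵐ x ∂μ, x ∉ S → ν (Prod.mk x ⁻¹' E) ≤ r) : μ.prod ν E ≤ μ S + r := by
  rw [Measure.prod_apply hE]
  calc ∫⁻ x, ν (Prod.mk x ⁻¹' E) ∂μ
      ≤ ∫⁻ x, ((toMeasurable μ S).indicator 1 x + r) ∂μ := by
        refine lintegral_mono_ae (h.mono fun x hx => ?_)
        by_cases hxS : x ∈ toMeasurable μ S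
        · rw [Set.indicator_of_mem hxS]
          exact prob_le_one.trans le_self_add
        · rw [Set.indicator_of_notMem hxS, zero_add]
          exact hx fun hS => hxS (subset_toMeasurable μ S hS)
    _ = μ S + r := by
        rw [lintegral_add_right _ measurable_const,
          lintegral_indicator_one (measurableSet_toMeasurable μ S), measure_toMeasurable,
          lintegral_const, measure_univ, mul_one]

theorem tendsto_ofReal_const_div_nat (C : ℝ) :
    Tendsto (fun n : ℕ => ENNReal.ofReal (C / n)) atTop (𝓝 0) := by
  simpa using ENNReal.tendsto_ofReal (tendsto_const_div_atTop_nhds_zero_nat C)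

variable {d : ℕ} {ΩX ΩY : Type*}

/-- The observations of the process `Y` at the first `n` points of the random design `s`. -/
def observations (s : ℕ → ΩX → EuclideanSpace ℝ (Fin d))
    (Y : EuclideanSpace ℝ (Fin d) → ΩY → ℝ) (n : ℕ) (ω : ΩX × ΩY) (i : Fin n) : ℝ :=
  Y (s i ω.1) ω.2

/-- The cross validation criterion of the covariance function `k`, as a random variable, for the
observations of `Y` at the first `n` points of the random design `s`. -/
noncomputable def randomCV (k : EuclideanSpace ℝ (Fin d) → ℝ)
    (s : ℕ → ΩX → EuclideanSpace ℝ (Fin d)) (Y : EuclideanSpace ℝ (Fin d) → ΩY → ℝ) (n : ℕ)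
    (ω : ΩX × ΩY) : ℝ :=
  cvCriterion k (fun i : Fin n => s i ω.1) (observations s Y n ω)

variable [MeasurableSpace ΩX] [MeasurableSpace ΩY]

/-- A centered Gaussian process `Y` with covariance function `k₀` is observed along an almost
surely `δ`-separated random design `s`. Independence of `s` and `Y` is encoded by the two factors
of the sample space `ΩX × ΩY`. -/
structure IsSeparatedSampling (δ : ℝ) (s : ℕ → ΩX → EuclideanSpace ℝ (Fin d)) (PX : Measure ΩX)
    (Y : EuclideanSpace ℝ (Fin d) → ΩY → ℝ) (PY : Measure ΩY)
    (k₀ : EuclideanSpace ℝ (Fin d) → ℝ) : Prop where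
  measurable_design : ∀ i, Measurable (s i)
  separated : ∀ᵐ x ∂PX, IsSeparatedFamily δ fun i => s i x
  process : IsCenteredGaussianProcess Y PY k₀
  measurable_obs : ∀ i, Measurable fun ω : ΩX × ΩY => Y (s i ω.1) ω.2

namespace IsSeparatedSampling

variable {δ l u : ℝ} {s : ℕ → ΩX → EuclideanSpace ℝ (Fin d)} {PX : Measure ΩX}
  {Y : EuclideanSpace ℝ (Fin d) → ΩY → ℝ} {PY : Measure ΩY}
  {k k₀ : EuclideanSpace ℝ (Fin d) → ℝ}

theorem ae_separated (h : IsSeparatedSampling δ s PX Y PY k₀) :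
    ∀ᵐ x ∂PX, ∀ n, IsSeparatedFamily δ fun i : Fin n => s i x :=
  h.separated.mono fun _ hx _ i j hij => hx i j (Fin.val_injective.ne hij)

theorem measurable_randomCV (h : IsSeparatedSampling δ s PX Y PY k₀) (hk : Measurable k) (n : ℕ) :
    Measurable (randomCV k s Y n : ΩX × ΩY → ℝ) :=
  measurable_cvCriterion hk (fun i => (h.measurable_design i).comp measurable_fst)
    fun i => h.measurable_obs i

variable [IsProbabilityMeasure PX] [IsProbabilityMeasure PY]

theorem tendsto_measure_two_mul_lt_sum_sq (h : IsSeparatedSampling δ s PX Y PY k₀)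
    (hR : ∀ {n : ℕ} {t : Fin n → EuclideanSpace ℝ (Fin d)}, IsSeparatedFamily δ t →
      HasSpectrumIn (covMatrix k₀ t) l u) (hk₀ : k₀ 0 = 1) :
    Tendsto (fun n : ℕ => PX.prod PY
      {ω | 2 * (n : ℝ) < observations s Y n ω ⬝ᵥ observations s Y n ω}) atTop (𝓝 0) := by
  refine tendsto_of_tendsto_of_tendsto_of_le_of_le' tendsto_const_nhds
    (tendsto_ofReal_const_div_nat (u ^ 2 * gaussianSqVariance))
    (Eventually.of_forall fun _ => zero_le) ((eventually_gt_atTop 0).mono fun n hn => ?_)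
  have hE : MeasurableSet
      {ω : ΩX × ΩY | 2 * (n : ℝ) < observations s Y n ω ⬝ᵥ observations s Y n ω} :=
    measurableSet_lt measurable_const <| Finset.measurable_sum _ fun i _ =>
      (h.measurable_obs i).mul (h.measurable_obs i)
  have hprod := measure_prod_le_add_of_ae_notMem (ν := PY) hE (S := ∅) <|
    h.ae_separated.mono fun x hx _ => h.process.measure_two_mul_lt_sum_sq_le (hR (hx n)) hk₀ hn
  rwa [measure_empty, zero_add] at hprod

theorem exists_tendsto_measure_randomCV_sub_lt (h : IsSeparatedSampling δ s PX Y PY k₀)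
    (hR₀ : ∀ {n : ℕ} {t : Fin n → EuclideanSpace ℝ (Fin d)}, IsSeparatedFamily δ t →
      HasSpectrumIn (covMatrix k₀ t) l u)
    (hR : ∀ {n : ℕ} {t : Fin n → EuclideanSpace ℝ (Fin d)}, IsSeparatedFamily δ t →
      HasSpectrumIn (covMatrix k t) l u)
    (hk₀_meas : Measurable k₀) (hk_meas : Measurable k) (hk₀ : k₀ 0 = 1) (hk : k 0 = 1)
    {c : ℝ} (hc : 0 < c)
    (hfrob : Tendsto (fun n : ℕ => PX {x | frobSq (covMatrix k (fun i : Fin n => s i x) -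
      covMatrix k₀ fun i : Fin n => s i x) < c * n}) atTop (𝓝 0)) :
    ∃ γ : ℝ, 0 < γ ∧ Tendsto (fun n : ℕ => PX.prod PY
      {ω | randomCV k s Y n ω - randomCV k₀ s Y n ω < γ * n}) atTop (𝓝 0) := by
  obtain ⟨x₀, hx₀⟩ := h.ae_separated.exists
  have hl := (hR₀ (hx₀ 0)).lower_pos
  have hu := (hR₀ (hx₀ 0)).upper_pos
  let M : ℝ := 4 * (1 + u ^ 2) * (u ^ 2 / l) ^ 2 / l
  have hM : 0 < M := by positivity
  refine ⟨c / M, div_pos hc hM, ?_⟩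
  have hlim := hfrob.add <| tendsto_ofReal_const_div_nat <|
    (u * (2 * (u ^ 2 / l ^ 2) * (2 * (u ^ 2 / l ^ 2)))) ^ 2 * gaussianSqVariance / (c / M) ^ 2
  rw [add_zero] at hlim
  refine tendsto_of_tendsto_of_tendsto_of_le_of_le' tendsto_const_nhds hlim
    (Eventually.of_forall fun _ => zero_le) ((eventually_gt_atTop 0).mono fun n hn => ?_)
  have hE : MeasurableSet {ω : ΩX × ΩY | randomCV k s Y n ω - randomCV k₀ s Y n ω < c / M * n} :=
    measurableSet_lt ((h.measurable_randomCV hk_meas n).sub (h.measurable_randomCV hk₀_meas n))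
      measurable_const
  refine measure_prod_le_add_of_ae_notMem hE (h.ae_separated.mono fun x hx hxS => ?_)
  refine h.process.measure_cvCriterion_sub_lt_le (hR₀ (hx n)) (hR (hx n)) hk₀ hk hn
    (div_pos hc hM) ?_
  rw [mul_div_cancel₀ c hM.ne']
  exact not_lt.1 hxS

variable {p : ℕ} {a b : ℝ} {K : (Fin p → ℝ) → EuclideanSpace ℝ (Fin d) → ℝ} {θ₀ : Fin p → ℝ}

theorem exists_tendsto_measure_lipschitz (h : IsSeparatedSampling δ s PX Y PY (K θ₀))
    (hK : IsRegularCovarianceModel a b K) (hδ : 0 < δ) (hθ₀ : θ₀ ∈ paramCube p a b)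
    (hKθ₀ : K θ₀ 0 = 1) :
    ∃ D : ℝ, 0 < D ∧ Tendsto (fun n : ℕ => PX.prod PY
      {ω | ∃ θ ∈ paramCube p a b, ∃ θ' ∈ paramCube p a b,
        D * dist θ θ' * n < |randomCV (K θ) s Y n ω - randomCV (K θ') s Y n ω|})
      atTop (𝓝 0) := by
  obtain ⟨l, u, hspec⟩ := hK.exists_hasSpectrumIn hδ
  obtain ⟨C, hC, hCK⟩ := hK.exists_norm_covMatrix_sub_le hδ
  obtain ⟨x₀, hx₀⟩ := h.ae_separated.exists
  have hl := (hspec θ₀ hθ₀ (hx₀ 0)).lower_pos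
  have hu := (hspec θ₀ hθ₀ (hx₀ 0)).upper_pos
  let M : ℝ := 2 * (u ^ 2 / l ^ 2) * (u ^ 2 / l ^ 3 + u ^ 4 / l ^ 5)
  have : 0 < M := by positivity
  refine ⟨2 * (M * (C + 1)), by positivity, ?_⟩
  refine tendsto_of_tendsto_of_tendsto_of_le_of_le tendsto_const_nhds
    (h.tendsto_measure_two_mul_lt_sum_sq (hspec θ₀ hθ₀) hKθ₀) (fun _ => zero_le)
    fun n => measure_mono_ae ?_
  filter_upwards [Measure.quasiMeasurePreserving_fst.ae h.ae_separated]
    with ω hω ⟨θ, hθ, θ', hθ', hlt⟩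
  refine lt_of_not_ge fun hle => hlt.not_ge ?_
  calc |randomCV (K θ) s Y n ω - randomCV (K θ') s Y n ω|
      ≤ M * ‖covMatrix (K θ) (fun i : Fin n => s i ω.1) - covMatrix (K θ') fun i => s i ω.1‖ *
          (observations s Y n ω ⬝ᵥ observations s Y n ω) :=
        (hspec θ hθ (hω n)).abs_cvCriterion_sub_le (hspec θ' hθ' (hω n)) _
    _ ≤ M * ((C + 1) * dist θ θ') * (2 * n) := by
        have hsub := hCK θ hθ θ' hθ' (hω n)
        rw [← dist_eq_norm θ] at hsub
        have hsub' := hsub.trans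
          (mul_le_mul_of_nonneg_right (le_add_of_nonneg_right zero_le_one) dist_nonneg)
        have : 0 ≤ observations s Y n ω ⬝ᵥ observations s Y n ω :=
          Finset.sum_nonneg fun i _ => mul_self_nonneg _
        gcongr
    _ = 2 * (M * (C + 1)) * dist θ θ' * n := by ring

theorem tendstoInMeasure_of_frobSq (h : IsSeparatedSampling δ s PX Y PY (K θ₀))
    (hK : IsRegularCovarianceModel a b K) (hK1 : ∀ θ ∈ paramCube p a b, K θ 0 = 1)
    (hδ : 0 < δ) (hθ₀ : θ₀ ∈ paramCube p a b)
    (hfrob : ∀ θ ∈ paramCube p a b, θ ≠ θ₀ → ∃ c : ℝ, 0 < c ∧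
      Tendsto (fun n : ℕ => PX {x | frobSq (covMatrix (K θ) (fun i : Fin n => s i x) -
        covMatrix (K θ₀) fun i : Fin n => s i x) < c * n}) atTop (𝓝 0))
    {θhat : ℕ → ΩX × ΩY → Fin p → ℝ}
    (hθhat : ∀ᶠ n in atTop, ∀ᵐ ω ∂(PX.prod PY), θhat n ω ∈ paramCube p a b ∧
      randomCV (K (θhat n ω)) s Y n ω ≤ randomCV (K θ₀) s Y n ω) :
    TendstoInMeasure (PX.prod PY) θhat atTop fun _ => θ₀ := by
  obtain ⟨l, u, hspec⟩ := hK.exists_hasSpectrumIn hδ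
  obtain ⟨D, hD, hlip⟩ := h.exists_tendsto_measure_lipschitz hK hδ hθ₀ (hK1 θ₀ hθ₀)
  refine tendstoInMeasure_of_isCompact_of_separated (isCompact_paramCube p a b)
    ((eventually_gt_atTop 0).mono fun n hn => Nat.cast_pos.2 hn) hD hlip
    (fun θ hθ hne => ?_) hθhat
  obtain ⟨c, hc, hc_lim⟩ := hfrob θ hθ hne
  exact h.exists_tendsto_measure_randomCV_sub_lt (hspec θ₀ hθ₀) (hspec θ hθ)
    (hK.continuous hθ₀).measurable (hK.continuous hθ).measurable (hK1 θ₀ hθ₀) (hK1 θ hθ) hc hc_lim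

end IsSeparatedSampling

end RandomDesign

section Grid

variable {d : ℕ} {v : ℕ → Fin d → ℕ}

open scoped Classical in
/-- The pairs of indices below `n` whose grid points differ by the lattice vector `w`. -/
noncomputable def gridPairs (v : ℕ → Fin d → ℕ) (w : Fin d → ℤ) (n : ℕ) : Finset (ℕ × ℕ) :=
  {e ∈ Finset.range n ×ˢ Finset.range n | ∀ k, (v e.1 k : ℤ) = v e.2 k + w k}

theorem mem_gridPairs {w : Fin d → ℤ} {n : ℕ} {e : ℕ × ℕ} :
    e ∈ gridPairs v w n ↔ (e.1 < n ∧ e.2 < n) ∧ ∀ k, (v e.1 k : ℤ) = v e.2 k + w k := by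
  simp only [gridPairs, Finset.mem_filter, Finset.mem_product, Finset.mem_range]

theorem fst_ne_snd_of_mem_gridPairs {w : Fin d → ℤ} (hw : w ≠ 0) {n : ℕ} {e : ℕ × ℕ}
    (he : e ∈ gridPairs v w n) : e.1 ≠ e.2 := by
  refine fun heq => hw (funext fun k => ?_)
  simpa [heq] using (mem_gridPairs.1 he).2 k

namespace IsGridEnumeration

theorem image_range (hv : IsGridEnumeration v) {N : ℕ} (hN : 1 ≤ N) :
    (Finset.range (N ^ d)).image v = Fintype.piFinset fun _ => Finset.Icc 1 N := by
  ext u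
  simpa using Set.ext_iff.1 (hv N hN) u

theorem injective (hv : IsGridEnumeration v) (hd : 1 ≤ d) : Function.Injective v := by
  intro i j hij
  have hN : max i j + 1 ≤ (max i j + 1) ^ d := Nat.le_self_pow (by omega) _
  have hinj : Set.InjOn v (Finset.range ((max i j + 1) ^ d)) := by
    refine Finset.injOn_of_card_image_eq ?_
    rw [hv.image_range (by omega), Fintype.card_piFinset]
    simp
  exact hinj (by simp; omega) (by simp; omega) hij

theorem isSeparatedFamily (hv : IsGridEnumeration v) (hd : 1 ≤ d) {ε : ℝ} (hε : 0 ≤ ε)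
    {x : ℕ → EuclideanSpace ℝ (Fin d)} (hx : ∀ i k, x i k ∈ Set.Icc (-1 : ℝ) 1) :
    IsSeparatedFamily (1 - 2 * ε) (obsPoint v ε x) := by
  intro i j hij
  obtain ⟨k, hk⟩ := Function.ne_iff.1 ((hv.injective hd).ne hij)
  have hgrid : (1 : ℝ) ≤ |(v i k : ℝ) - v j k| := by
    exact_mod_cast Int.one_le_abs (z := (v i k : ℤ) - v j k) (by omega)
  have hpert : |ε * (x i k - x j k)| ≤ 2 * ε := by
    rw [abs_mul, abs_of_nonneg hε, mul_comm]
    refine mul_le_mul_of_nonneg_right (abs_le.2 ?_) hε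
    constructor <;> linarith [(hx i k).1, (hx i k).2, (hx j k).1, (hx j k).2]
  calc 1 - 2 * ε ≤ |(v i k : ℝ) - v j k| - |ε * (x i k - x j k)| := sub_le_sub hgrid hpert
    _ ≤ |(v i k : ℝ) - v j k + ε * (x i k - x j k)| := by
      simpa only [abs_neg, sub_neg_eq_add] using
        abs_sub_abs_le_abs_sub ((v i k : ℝ) - v j k) (-(ε * (x i k - x j k)))
    _ = ‖(obsPoint v ε x i - obsPoint v ε x j) k‖ := by
      rw [Real.norm_eq_abs]
      congr 1
      simp only [obsPoint, PiLp.sub_apply, PiLp.add_apply, PiLp.smul_apply, smul_eq_mul]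
      ring
    _ ≤ ‖obsPoint v ε x i - obsPoint v ε x j‖ := PiLp.norm_apply_le _ k

theorem injOn_fst_gridPairs (hv : IsGridEnumeration v) (hd : 1 ≤ d) (w : Fin d → ℤ) (n : ℕ) :
    Set.InjOn Prod.fst (gridPairs v w n : Set (ℕ × ℕ)) := by
  intro e he f hf hef
  refine Prod.ext hef (hv.injective hd (funext fun k => ?_))
  have he' := (mem_gridPairs.1 he).2 k
  have hf' := (mem_gridPairs.1 hf).2 k
  rw [hef] at he'
  omega

theorem injOn_snd_gridPairs (hv : IsGridEnumeration v) (hd : 1 ≤ d) (w : Fin d → ℤ) (n : ℕ) :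
    Set.InjOn Prod.snd (gridPairs v w n : Set (ℕ × ℕ)) := by
  intro e he f hf hef
  refine Prod.ext (hv.injective hd (funext fun k => ?_)) hef
  have he' := (mem_gridPairs.1 he).2 k
  have hf' := (mem_gridPairs.1 hf).2 k
  rw [hef] at he'
  omega

theorem exists_lt_pow_apply_eq (hv : IsGridEnumeration v) {N : ℕ} (hN : 1 ≤ N) {u : Fin d → ℕ}
    (hu : ∀ k, 1 ≤ u k ∧ u k ≤ N) : ∃ i < N ^ d, v i = u := by
  have : u ∈ v '' {i | i < N ^ d} := by rwa [hv N hN]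
  exact this

theorem sub_pow_le_card_gridPairs (hv : IsGridEnumeration v) {w : Fin d → ℤ} {H N n : ℕ}
    (hwH : ∀ k, (w k).natAbs ≤ H) (hN : 1 ≤ N) (hNn : N ^ d ≤ n) :
    (N - 2 * H) ^ d ≤ (gridPairs v w n).card := by
  classical
  -- the points of `[1 + H, N - H]^d` have their translates by `w` in `[1, N]^d`
  have hsub : (Fintype.piFinset fun _ : Fin d => Finset.Icc (1 + H) (N - H)) ⊆
      (gridPairs v w n).image fun e => v e.2 := by
    intro u hu
    simp only [Fintype.mem_piFinset, Finset.mem_Icc] at hu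
    obtain ⟨i, hi, hiu⟩ := hv.exists_lt_pow_apply_eq hN fun k => by
      have := hu k
      exact (⟨by omega, by omega⟩ : 1 ≤ u k ∧ u k ≤ N)
    obtain ⟨j, hj, hju⟩ := hv.exists_lt_pow_apply_eq hN fun k => by
      have := hu k
      have := hwH k
      exact (⟨by omega, by omega⟩ : 1 ≤ ((u k : ℤ) + w k).toNat ∧ ((u k : ℤ) + w k).toNat ≤ N)
    refine Finset.mem_image.2 ⟨(j, i), mem_gridPairs.2 ⟨⟨by omega, by omega⟩, fun k => ?_⟩, hiu⟩
    have := hu k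
    have := hwH k
    simp only [hju, hiu]
    omega
  calc (N - 2 * H) ^ d = (Fintype.piFinset fun _ : Fin d => Finset.Icc (1 + H) (N - H)).card := by
        rw [Fintype.card_piFinset, Finset.prod_const, Nat.card_Icc, Finset.card_univ,
          Fintype.card_fin]
        congr 1
        omega
    _ ≤ (gridPairs v w n).card := (Finset.card_le_card hsub).trans Finset.card_image_le

theorem eventually_le_card_gridPairs (hv : IsGridEnumeration v) (hd : 1 ≤ d) (w : Fin d → ℤ) :
    ∀ᶠ n : ℕ in atTop, (n : ℝ) / 4 ^ d ≤ (gridPairs v w n).card := by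
  let H : ℕ := ∑ k, (w k).natAbs
  have hwH (k) : (w k).natAbs ≤ H :=
    Finset.single_le_sum (f := fun k => (w k).natAbs) (fun _ _ => Nat.zero_le _)
      (Finset.mem_univ k)
  filter_upwards [eventually_ge_atTop ((4 * H + 1) ^ d)] with n hn
  let N := Nat.findGreatest (fun N => N ^ d ≤ n) n
  have hle : 4 * H + 1 ≤ n := (Nat.le_self_pow (by omega) _).trans hn
  have hNH : 4 * H + 1 ≤ N := Nat.le_findGreatest hle hn
  have hNn : N ^ d ≤ n := Nat.findGreatest_spec (P := fun N => N ^ d ≤ n) hle hn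
  have hnN : n < (N + 1) ^ d := by
    by_contra! hcon
    exact absurd (Nat.le_findGreatest (P := fun N => N ^ d ≤ n)
      ((Nat.le_self_pow (by omega) _).trans hcon) hcon) (by simp [N])
  rw [div_le_iff₀ (by positivity)]
  exact_mod_cast calc
    n ≤ (N + 1) ^ d := hnN.le
    _ ≤ ((N - 2 * H) * 4) ^ d := Nat.pow_le_pow_left (by omega) d
    _ = (N - 2 * H) ^ d * 4 ^ d := mul_pow _ _ _
    _ ≤ (gridPairs v w n).card * 4 ^ d :=
      Nat.mul_le_mul_right _ (hv.sub_pow_le_card_gridPairs hwH (by omega) hNn)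

end IsGridEnumeration

end Grid

section PairCounts

variable {ι Ω E : Type*} [MeasurableSpace Ω] [MeasurableSpace E] {P : Measure Ω}
  {X : ι → Ω → E} {L : Measure E} {W : Set (E × E)}

/-- The indicator of the event that the pair of variables with indices `e` falls in `W`. -/
noncomputable def pairIndicator (X : ι → Ω → E) (W : Set (E × E)) (e : ι × ι) (ω : Ω) : ℝ :=
  W.indicator 1 (X e.1 ω, X e.2 ω)

theorem pairIndicator_mem_Icc {Ω E : Type*} (X : ι → Ω → E) (W : Set (E × E)) (e : ι × ι)
    (ω : Ω) : pairIndicator X W e ω ∈ Set.Icc (0 : ℝ) 1 := by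
  by_cases h : (X e.1 ω, X e.2 ω) ∈ W <;> simp [pairIndicator, h]

theorem measurable_pairIndicator (hXm : ∀ i, Measurable (X i)) (hW : MeasurableSet W)
    (e : ι × ι) : Measurable (pairIndicator X W e) :=
  (measurable_one.indicator hW).comp ((hXm e.1).prodMk (hXm e.2))

theorem integral_pairIndicator [IsFiniteMeasure P] (hXm : ∀ i, Measurable (X i))
    (hXlaw : ∀ i, P.map (X i) = L) (hX : iIndepFun X P) (hW : MeasurableSet W) {e : ι × ι}
    (he : e.1 ≠ e.2) : ∫ ω, pairIndicator X W e ω ∂P = (L.prod L).real W := by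
  have hjoint : P.map (fun ω => (X e.1 ω, X e.2 ω)) = L.prod L := by
    rw [(indepFun_iff_map_prod_eq_prod_map_map (hXm _).aemeasurable (hXm _).aemeasurable).1
      (hX.indepFun he), hXlaw, hXlaw]
  rw [← hjoint, ← integral_indicator_one hW]
  exact (integral_map ((hXm e.1).prodMk (hXm e.2)).aemeasurable
    (measurable_one.indicator hW).aestronglyMeasurable).symm

variable [IsProbabilityMeasure P]

theorem memLp_pairIndicator (hXm : ∀ i, Measurable (X i)) (hW : MeasurableSet W) (e : ι × ι) :
    MemLp (pairIndicator X W e) 2 P := by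
  refine MemLp.of_bound (measurable_pairIndicator hXm hW e).aestronglyMeasurable 1
    (ae_of_all _ fun ω => ?_)
  have h := pairIndicator_mem_Icc X W e ω
  rw [Real.norm_of_nonneg h.1]
  exact h.2

theorem covariance_pairIndicator_le_one (hXm : ∀ i, Measurable (X i)) (hW : MeasurableSet W)
    (e f : ι × ι) : cov[pairIndicator X W e, pairIndicator X W f; P] ≤ 1 := by
  have hmean (e) : 0 ≤ ∫ ω, pairIndicator X W e ω ∂P :=
    integral_nonneg fun ω => (pairIndicator_mem_Icc X W e ω).1
  have he := memLp_pairIndicator (P := P) hXm hW e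
  have hf := memLp_pairIndicator (P := P) hXm hW f
  rw [covariance_eq_sub he hf]
  refine (sub_le_self _ (mul_nonneg (hmean e) (hmean f))).trans ?_
  calc ∫ ω, (pairIndicator X W e * pairIndicator X W f) ω ∂P ≤ ∫ _, (1 : ℝ) ∂P :=
        integral_mono (he.integrable_mul hf) (integrable_const 1) fun ω =>
          mul_le_one₀ (pairIndicator_mem_Icc X W e ω).2 (pairIndicator_mem_Icc X W f ω).1
            (pairIndicator_mem_Icc X W f ω).2
    _ = 1 := by simp

theorem covariance_pairIndicator_eq_zero (hXm : ∀ i, Measurable (X i)) (hX : iIndepFun X P)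
    (hW : MeasurableSet W) {e f : ι × ι} (h₁₁ : e.1 ≠ f.1) (h₁₂ : e.1 ≠ f.2) (h₂₁ : e.2 ≠ f.1)
    (h₂₂ : e.2 ≠ f.2) : cov[pairIndicator X W e, pairIndicator X W f; P] = 0 :=
  ((hX.indepFun_prodMk_prodMk hXm _ _ _ _ h₁₁ h₁₂ h₂₁ h₂₂).comp (measurable_one.indicator hW)
    (measurable_one.indicator hW)).covariance_eq_zero
    (memLp_pairIndicator hXm hW e) (memLp_pairIndicator hXm hW f)

theorem sum_covariance_pairIndicator_le (hXm : ∀ i, Measurable (X i)) (hX : iIndepFun X P)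
    (hW : MeasurableSet W) {G : Finset (ι × ι)} (hfst : Set.InjOn Prod.fst (G : Set (ι × ι)))
    (hsnd : Set.InjOn Prod.snd (G : Set (ι × ι))) {e : ι × ι} (he : e ∈ G) :
    ∑ f ∈ G, cov[pairIndicator X W e, pairIndicator X W f; P] ≤ 3 := by
  classical
  -- only `e` itself and the pairs chained to it, at either end, can be correlated with `e`
  have hle : ∀ f ∈ G, cov[pairIndicator X W e, pairIndicator X W f; P] ≤
      if f = e ∨ f.1 = e.2 ∨ f.2 = e.1 then 1 else 0 := by
    intro f hf
    split_ifs with h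
    · exact covariance_pairIndicator_le_one hXm hW e f
    · push Not at h
      exact (covariance_pairIndicator_eq_zero hXm hX hW (fun h' => h.1 (hfst hf he h'.symm))
        h.2.2.symm h.2.1.symm fun h' => h.1 (hsnd hf he h'.symm)).le
  have hself : ({f ∈ G | f = e} : Finset _).card ≤ 1 := Finset.card_le_one.2 fun f hf g hg =>
    (Finset.mem_filter.1 hf).2.trans (Finset.mem_filter.1 hg).2.symm
  have hright : ({f ∈ G | f.1 = e.2} : Finset _).card ≤ 1 := Finset.card_le_one.2 fun f hf g hg =>
    hfst (Finset.mem_filter.1 hf).1 (Finset.mem_filter.1 hg).1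
      ((Finset.mem_filter.1 hf).2.trans (Finset.mem_filter.1 hg).2.symm)
  have hleft : ({f ∈ G | f.2 = e.1} : Finset _).card ≤ 1 := Finset.card_le_one.2 fun f hf g hg =>
    hsnd (Finset.mem_filter.1 hf).1 (Finset.mem_filter.1 hg).1
      ((Finset.mem_filter.1 hf).2.trans (Finset.mem_filter.1 hg).2.symm)
  refine (Finset.sum_le_sum hle).trans ?_
  rw [Finset.sum_boole, Finset.filter_or, Finset.filter_or]
  have hunion := (Finset.card_union_le {f ∈ G | f = e}
    ({f ∈ G | f.1 = e.2} ∪ {f ∈ G | f.2 = e.1})).trans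
    (Nat.add_le_add_left (Finset.card_union_le _ _) _)
  exact_mod_cast hunion.trans (add_le_add hself (add_le_add hright hleft))

theorem measure_sum_pairIndicator_lt_le (hXm : ∀ i, Measurable (X i))
    (hXlaw : ∀ i, P.map (X i) = L) (hX : iIndepFun X P) (hW : MeasurableSet W)
    (hWpos : 0 < (L.prod L).real W) {G : Finset (ι × ι)} (hne : ∀ e ∈ G, e.1 ≠ e.2)
    (hfst : Set.InjOn Prod.fst (G : Set (ι × ι))) (hsnd : Set.InjOn Prod.snd (G : Set (ι × ι)))
    (hG : G.Nonempty) :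
    P {ω | ∑ e ∈ G, pairIndicator X W e ω < G.card * (L.prod L).real W / 2} ≤
      ENNReal.ofReal (12 / (G.card * (L.prod L).real W ^ 2)) := by
  let T : Ω → ℝ := fun ω => ∑ e ∈ G, pairIndicator X W e ω
  let q : ℝ := (L.prod L).real W
  have hq : 0 < q := hWpos
  have hmean : ∫ ω, T ω ∂P = G.card * q := by
    rw [integral_finsetSum _ fun e _ => (memLp_pairIndicator hXm hW e).integrable one_le_two,
      Finset.sum_congr rfl fun e he => integral_pairIndicator hXm hXlaw hX hW (hne e he),
      Finset.sum_const, nsmul_eq_mul]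
  have hvar : Var[T; P] ≤ G.card * 3 := by
    rw [variance_fun_sum' fun e _ => memLp_pairIndicator hXm hW e, ← nsmul_eq_mul]
    exact Finset.sum_le_card_nsmul _ _ _ fun e he =>
      sum_covariance_pairIndicator_le hXm hX hW hfst hsnd he
  have : (0 : ℝ) < G.card := Nat.cast_pos.2 hG.card_pos
  calc P {ω | T ω < G.card * q / 2} ≤ P {ω | G.card * q / 2 ≤ |T ω - ∫ ω, T ω ∂P|} := by
        refine measure_mono fun ω (hω : T ω < G.card * q / 2) => ?_
        change _ ≤ |T ω - _|
        rw [hmean, abs_sub_comm]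
        exact le_trans (by linarith) (le_abs_self _)
    _ ≤ ENNReal.ofReal (Var[T; P] / (G.card * q / 2) ^ 2) :=
        meas_ge_le_variance_div_sq (memLp_finsetSum _ fun e _ => memLp_pairIndicator hXm hW e)
          (by positivity)
    _ ≤ ENNReal.ofReal (G.card * 3 / (G.card * q / 2) ^ 2) := by gcongr
    _ = ENNReal.ofReal (12 / (G.card * q ^ 2)) := by
        congr 1
        field_simp
        norm_num

end PairCounts

section Contrast

variable {d : ℕ} {ε : ℝ} {g : EuclideanSpace ℝ (Fin d) → ℝ}

/-- The pairs of perturbations for which two grid points with difference `w`, once perturbed, have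
a difference where the function `g` is at least `c` in absolute value. -/
def contrastPairs (g : EuclideanSpace ℝ (Fin d) → ℝ) (ε : ℝ) (w : Fin d → ℤ) (c : ℝ) :
    Set (EuclideanSpace ℝ (Fin d) × EuclideanSpace ℝ (Fin d)) :=
  {z | c ≤ |g (WithLp.toLp 2 (fun k => (w k : ℝ)) + ε • (z.1 - z.2))|}

theorem measurableSet_contrastPairs (hg : Measurable g) (w : Fin d → ℤ) (c : ℝ) :
    MeasurableSet (contrastPairs g ε w c) :=
  measurableSet_le measurable_const (by fun_prop)

theorem exists_measure_contrastPairs_pos {L : Measure (EuclideanSpace ℝ (Fin d))} [SFinite L]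
    (hg : Continuous g) {t : EuclideanSpace ℝ (Fin d)} (ht : t ∈ interpointSet ε L.support)
    (hgt : g t ≠ 0) :
    ∃ w : Fin d → ℤ, w ≠ 0 ∧ ∃ c : ℝ, 0 < c ∧ 0 < (L.prod L) (contrastPairs g ε w c) := by
  obtain ⟨w, hw, t₁, ht₁, t₂, ht₂, rfl⟩ := ht
  let f : EuclideanSpace ℝ (Fin d) × EuclideanSpace ℝ (Fin d) → ℝ := fun z =>
    |g (WithLp.toLp 2 (fun k => (w k : ℝ)) + ε • (z.1 - z.2))|
  have hf : Continuous f := by fun_prop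
  have hpos : 0 < f (t₁, t₂) := abs_pos.2 hgt
  obtain ⟨U, V, hUo, hU, hVo, hV, hUV⟩ := mem_nhds_prod_iff'.1 <|
    (isOpen_lt continuous_const hf).mem_nhds (half_lt_self hpos : (t₁, t₂) ∈ _)
  refine ⟨w, hw, f (t₁, t₂) / 2, half_pos hpos, ?_⟩
  calc 0 < L U * L V := ENNReal.mul_pos
        ((Measure.mem_support_iff_forall t₁).1 ht₁ U (hUo.mem_nhds hU)).ne'
        ((Measure.mem_support_iff_forall t₂).1 ht₂ V (hVo.mem_nhds hV)).ne'
    _ = (L.prod L) (U ×ˢ V) := (Measure.prod_prod U V).symm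
    _ ≤ (L.prod L) (contrastPairs g ε w (f (t₁, t₂) / 2)) :=
        measure_mono fun z hz => (show f (t₁, t₂) / 2 < f z from hUV hz).le

variable {v : ℕ → Fin d → ℕ}

theorem obsPoint_sub_obsPoint (x : ℕ → EuclideanSpace ℝ (Fin d)) {w : Fin d → ℤ} {n : ℕ}
    {e : ℕ × ℕ} (he : e ∈ gridPairs v w n) :
    obsPoint v ε x e.1 - obsPoint v ε x e.2 =
      WithLp.toLp 2 (fun k => (w k : ℝ)) + ε • (x e.1 - x e.2) := by
  ext k
  have hk : (v e.1 k : ℝ) = v e.2 k + w k := by exact_mod_cast (mem_gridPairs.1 he).2 k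
  simp only [obsPoint, PiLp.sub_apply, PiLp.add_apply, PiLp.smul_apply, smul_eq_mul, hk]
  ring

variable {Ω : Type*} {X : ℕ → Ω → EuclideanSpace ℝ (Fin d)}

theorem sum_pairIndicator_le_frobSq {w : Fin d → ℤ} {c : ℝ} (hc : 0 ≤ c) (n : ℕ) (ω : Ω) :
    c ^ 2 * ∑ e ∈ gridPairs v w n, pairIndicator X (contrastPairs g ε w c) e ω ≤
      frobSq (covMatrix g fun i : Fin n => obsPoint v ε (fun j => X j ω) i) := by
  let F (e : ℕ × ℕ) : ℝ :=
    g (obsPoint v ε (fun j => X j ω) e.1 - obsPoint v ε (fun j => X j ω) e.2) ^ 2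
  rw [Finset.mul_sum]
  calc ∑ e ∈ gridPairs v w n, c ^ 2 * pairIndicator X (contrastPairs g ε w c) e ω
      ≤ ∑ e ∈ gridPairs v w n, F e := by
        refine Finset.sum_le_sum fun e he => ?_
        by_cases hX : (X e.1 ω, X e.2 ω) ∈ contrastPairs g ε w c
        · rw [pairIndicator, Set.indicator_of_mem hX, Pi.one_apply, mul_one]
          simp only [F, obsPoint_sub_obsPoint _ he]
          exact (pow_le_pow_left₀ hc hX 2).trans_eq (sq_abs _)
        · rw [pairIndicator, Set.indicator_of_notMem hX, mul_zero]
          exact sq_nonneg _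
    _ ≤ ∑ e ∈ Finset.range n ×ˢ Finset.range n, F e :=
        Finset.sum_le_sum_of_subset_of_nonneg
          (fun e he => by simpa using (mem_gridPairs.1 he).1) fun e _ _ => sq_nonneg _
    _ = frobSq (covMatrix g fun i : Fin n => obsPoint v ε (fun j => X j ω) i) := by
        simp only [Finset.sum_product, Finset.sum_range]
        rfl

variable [MeasurableSpace Ω] {P : Measure Ω} [IsProbabilityMeasure P]
  {L : Measure (EuclideanSpace ℝ (Fin d))}

theorem IsGridEnumeration.exists_tendsto_measure_frobSq_lt (hv : IsGridEnumeration v) (hd : 1 ≤ d)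
    (hXm : ∀ i, Measurable (X i)) (hXlaw : ∀ i, P.map (X i) = L) (hX : iIndepFun X P)
    (hg : Continuous g) {t : EuclideanSpace ℝ (Fin d)} (ht : t ∈ interpointSet ε L.support)
    (hgt : g t ≠ 0) :
    ∃ c : ℝ, 0 < c ∧ Tendsto (fun n : ℕ => P {ω | frobSq
      (covMatrix g fun i : Fin n => obsPoint v ε (fun j => X j ω) i) < c * n}) atTop (𝓝 0) := by
  have : IsProbabilityMeasure L :=
    hXlaw 0 ▸ Measure.isProbabilityMeasure_map (hXm 0).aemeasurable
  obtain ⟨w, hw, c, hc, hpos⟩ := exists_measure_contrastPairs_pos hg ht hgt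
  let q : ℝ := (L.prod L).real (contrastPairs g ε w c)
  have hq : 0 < q := ENNReal.toReal_pos hpos.ne' (measure_ne_top _ _)
  refine ⟨c ^ 2 * q / (2 * 4 ^ d), by positivity, ?_⟩
  refine tendsto_of_tendsto_of_tendsto_of_le_of_le' tendsto_const_nhds
    (tendsto_ofReal_const_div_nat (12 * 4 ^ d / q ^ 2)) (Eventually.of_forall fun _ => zero_le) ?_
  filter_upwards [hv.eventually_le_card_gridPairs hd w, eventually_gt_atTop 0] with n hcard hn
  have : (0 : ℝ) < n := Nat.cast_pos.2 hn
  let G := gridPairs v w n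
  have hG : (0 : ℝ) < G.card := lt_of_lt_of_le (by positivity) hcard
  calc P {ω | frobSq (covMatrix g fun i : Fin n => obsPoint v ε (fun j => X j ω) i) <
          c ^ 2 * q / (2 * 4 ^ d) * n}
      ≤ P {ω | ∑ e ∈ G, pairIndicator X (contrastPairs g ε w c) e ω < G.card * q / 2} := by
        refine measure_mono fun ω hω => lt_of_mul_lt_mul_left ?_ (sq_nonneg c)
        calc _ ≤ _ := sum_pairIndicator_le_frobSq hc.le n ω
          _ < c ^ 2 * q / (2 * 4 ^ d) * n := hω
          _ = c ^ 2 * (n / 4 ^ d * q / 2) := by ring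
          _ ≤ c ^ 2 * (G.card * q / 2) := by gcongr
    _ ≤ ENNReal.ofReal (12 / (G.card * q ^ 2)) :=
        measure_sum_pairIndicator_lt_le hXm hXlaw hX (measurableSet_contrastPairs hg.measurable w c)
          hq (fun e he => fst_ne_snd_of_mem_gridPairs hw he) (hv.injOn_fst_gridPairs hd w n)
          (hv.injOn_snd_gridPairs hd w n) (Finset.card_pos.1 (Nat.cast_pos.1 hG))
    _ ≤ ENNReal.ofReal (12 / (n / 4 ^ d * q ^ 2)) := by gcongr
    _ = ENNReal.ofReal (12 * 4 ^ d / q ^ 2 / n) := by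
        congr 1
        field_simp

end Contrast

section Consistency

variable {d : ℕ}

theorem ae_mem_Icc_of_forall_mem_support {Ω : Type*} [MeasurableSpace Ω] {P : Measure Ω}
    {X : ℕ → Ω → EuclideanSpace ℝ (Fin d)} {L : Measure (EuclideanSpace ℝ (Fin d))}
    (hXm : ∀ i, Measurable (X i)) (hXlaw : ∀ i, P.map (X i) = L)
    (hL : ∀ x ∈ L.support, ∀ k, x k ∈ Set.Icc (-1 : ℝ) 1) :
    ∀ᵐ ω ∂P, ∀ i k, X i ω k ∈ Set.Icc (-1 : ℝ) 1 :=
  ae_all_iff.2 fun i => (ae_of_ae_map (hXm i).aemeasurable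
    (by rw [hXlaw]; exact Measure.support_mem_ae)).mono fun ω hω => hL (X i ω) hω

theorem measurable_obsPoint {Ω : Type*} [MeasurableSpace Ω]
    {X : ℕ → Ω → EuclideanSpace ℝ (Fin d)} (hXm : ∀ i, Measurable (X i)) (v : ℕ → Fin d → ℕ)
    (ε : ℝ) (i : ℕ) : Measurable fun ω => obsPoint v ε (fun j => X j ω) i :=
  ((hXm i).const_smul ε).const_add _

theorem eq_on_lattice_of_eqOn_interpointSet_zero {S : Set (EuclideanSpace ℝ (Fin d))}
    (hS : S.Nonempty) {g h : EuclideanSpace ℝ (Fin d) → ℝ} (h0 : g 0 = h 0)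
    (heq : Set.EqOn g h (interpointSet 0 S)) (u : Fin d → ℤ) :
    g (WithLp.toLp 2 fun k => (u k : ℝ)) = h (WithLp.toLp 2 fun k => (u k : ℝ)) := by
  obtain rfl | hu := eq_or_ne u 0
  · have hzero : WithLp.toLp 2 (fun k => (((0 : Fin d → ℤ) k : ℤ) : ℝ)) =
        (0 : EuclideanSpace ℝ (Fin d)) := by ext k; simp
    rw [hzero, h0]
  · obtain ⟨t, ht⟩ := hS
    exact heq ⟨u, hu, t, ht, t, ht, by rw [zero_smul, add_zero]⟩

theorem ae_restrict_eq_of_eqOn {α β : Type*} [TopologicalSpace α] [MeasurableSpace α]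
    [OpensMeasurableSpace α] [TopologicalSpace β] [T2Space β] {μ : Measure α} {S : Set α}
    {g h : α → β} (hg : Continuous g) (hh : Continuous h) (heq : Set.EqOn g h S) :
    ∀ᵐ t ∂(μ.restrict S), g t = h t :=
  (ae_restrict_iff (isClosed_eq hg hh).measurableSet).2 (ae_of_all _ fun _ ht => heq ht)

theorem mainTheorem4_general {p : ℕ} (hd : 1 ≤ d) (a b : ℝ) (θ₀ : Fin p → ℝ)
    (hθ₀ : θ₀ ∈ paramCube p a b)
    (K : (Fin p → ℝ) → EuclideanSpace ℝ (Fin d) → ℝ)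
    (hK : IsRegularCovarianceModel a b K)
    (hK1 : ∀ θ ∈ paramCube p a b, K θ 0 = 1)
    (v : ℕ → Fin d → ℕ) (hv : IsGridEnumeration v)
    (ε : ℝ) (hε0 : 0 ≤ ε) (hε : ε < 1 / 2)
    (L : Measure (EuclideanSpace ℝ (Fin d)))
    (hL : ∀ x ∈ L.support, ∀ k, x k ∈ Set.Icc (-1 : ℝ) 1)
    {ΩX ΩY : Type*} [MeasurableSpace ΩX] [MeasurableSpace ΩY]
    (PX : Measure ΩX) [IsProbabilityMeasure PX] (PY : Measure ΩY) [IsProbabilityMeasure PY]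
    (X : ℕ → ΩX → EuclideanSpace ℝ (Fin d)) (hXm : ∀ i, Measurable (X i))
    (hXlaw : ∀ i, PX.map (X i) = L) (hXindep : iIndepFun X PX)
    (Y : EuclideanSpace ℝ (Fin d) → ΩY → ℝ)
    (hY : IsCenteredGaussianProcess Y PY (K θ₀))
    (hYm : ∀ i, Measurable
      (fun ω : ΩX × ΩY => Y (obsPoint v ε (fun j => X j ω.1) i) ω.2))
    (θhat : ℕ → ΩX × ΩY → Fin p → ℝ)
    (hθhat : IsCVEstimator a b K v ε PX X PY Y θhat)
    (hid : ¬ ∃ θ ∈ paramCube p a b, θ ≠ θ₀ ∧ Set.EqOn (K θ) (K θ₀) (interpointSet ε L.support)) :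
    TendstoInMeasure (PX.prod PY) θhat atTop (fun _ => θ₀) := by
  have hsampling : IsSeparatedSampling (1 - 2 * ε) (fun i x => obsPoint v ε (fun j => X j x) i)
      PX Y PY (K θ₀) :=
    { measurable_design := measurable_obsPoint hXm v ε
      separated := (ae_mem_Icc_of_forall_mem_support hXm hXlaw hL).mono fun _ hx =>
        hv.isSeparatedFamily hd hε0 hx
      process := hY
      measurable_obs := hYm }
  refine hsampling.tendstoInMeasure_of_frobSq hK hK1 (by linarith) hθ₀ (fun θ hθ hne => ?_) ?_
  · obtain ⟨t, ht, hKt⟩ : ∃ t ∈ interpointSet ε L.support, K θ t ≠ K θ₀ t := by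
      by_contra! heq
      exact hid ⟨θ, hθ, hne, heq⟩
    simp only [covMatrix_sub]
    exact hv.exists_tendsto_measure_frobSq_lt hd hXm hXlaw hXindep
      ((hK.continuous hθ).sub (hK.continuous hθ₀)) ht (sub_ne_zero.2 hKt)
  · exact (eventually_ge_atTop 1).mono fun n hn => (hθhat n hn).mono fun ω hω =>
      ⟨hω.1, hω.2 θ₀ hθ₀⟩

end Consistency

theorem mainTheorem4 {d p : ℕ} (hd : 1 ≤ d)
    -- parameter space and true parameter, in its interior
    (a b : ℝ) (θ₀ : Fin p → ℝ) (hθ₀ : ∀ i, a < θ₀ i ∧ θ₀ i < b)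
    -- regular model of correlation functions
    (K : (Fin p → ℝ) → EuclideanSpace ℝ (Fin d) → ℝ)
    (hK : IsRegularCovarianceModel a b K)
    (hK1 : ∀ θ ∈ paramCube p a b, K θ 0 = 1)
    -- perturbed regular grid
    (v : ℕ → Fin d → ℕ) (hv : IsGridEnumeration v)
    (ε : ℝ) (hε0 : 0 ≤ ε) (hε : ε < 1 / 2)
    (L : Measure (EuclideanSpace ℝ (Fin d))) (hL : IsPerturbationLaw L)
    {ΩX ΩY : Type*} [MeasurableSpace ΩX] [MeasurableSpace ΩY]
    (PX : Measure ΩX) [IsProbabilityMeasure PX] (PY : Measure ΩY) [IsProbabilityMeasure PY]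
    (X : ℕ → ΩX → EuclideanSpace ℝ (Fin d)) (hXm : ∀ i, Measurable (X i))
    (hXlaw : ∀ i, PX.map (X i) = L) (hXindep : iIndepFun X PX)
    -- Gaussian process, independent of the perturbations (product space)
    (Y : EuclideanSpace ℝ (Fin d) → ΩY → ℝ)
    (hY : IsCenteredGaussianProcess Y PY (K θ₀))
    -- the observations `y_i` are random variables
    (hYm : ∀ i, Measurable
      (fun ω : ΩX × ΩY => Y (obsPoint v ε (fun j => X j ω.1) i) ω.2))
    -- any cross validation estimator
    (θhat : ℕ → ΩX × ΩY → Fin p → ℝ)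
    (hθhat : IsCVEstimator a b K v ε PX X PY Y θhat) :
    (ε = 0 →
      (¬ ∃ θ ∈ paramCube p a b, θ ≠ θ₀ ∧
        ∀ u : Fin d → ℤ, K θ (WithLp.toLp 2 (fun k => (u k : ℝ))) =
          K θ₀ (WithLp.toLp 2 (fun k => (u k : ℝ)))) →
      TendstoInMeasure (PX.prod PY) θhat atTop (fun _ => θ₀)) ∧
    (ε ≠ 0 →
      (¬ ∃ θ ∈ paramCube p a b, θ ≠ θ₀ ∧
        ∀ᵐ t ∂(volume.restrict (interpointSet ε L.support)), K θ t = K θ₀ t) →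
      TendstoInMeasure (PX.prod PY) θhat atTop (fun _ => θ₀)) := by
  have hθ₀' : θ₀ ∈ paramCube p a b := fun i => ⟨(hθ₀ i).1.le, (hθ₀ i).2.le⟩
  have := hL.prob
  have hsupp : L.support.Nonempty := Measure.nonempty_support (NeZero.ne L)
  refine ⟨fun hε_zero hid => ?_, fun _ hid => ?_⟩ <;>
    refine mainTheorem4_general hd a b θ₀ hθ₀' K hK hK1 v hv ε hε0 hε L hL.support_subset PX PY X
      hXm hXlaw hXindep Y hY hYm θhat hθhat fun ⟨θ, hθ, hne, heq⟩ => hid ⟨θ, hθ, hne, ?_⟩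
  · exact eq_on_lattice_of_eqOn_interpointSet_zero hsupp ((hK1 θ hθ).trans (hK1 θ₀ hθ₀').symm)
      (hε_zero ▸ heq)
  · exact ae_restrict_eq_of_eqOn (hK.continuous hθ) (hK.continuous hθ₀') heq
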